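/- Let $\mu,\nu$ be probability measures on the Borel sets of $(0,\infty)$. Let $\Omega=(0,\infty)^{\mathbb N}\times(0,\infty)^{\mathbb N}$ with its Borel $\sigma$-algebra $\Sigma$, let $P=\mu^{\otimes\mathbb N}\otimes\nu^{\otimes\mathbb N}$, and let $W_n$ and $X_n$ $(n\ge1)$ be the coordinate maps on the first and on the second factor. Put $T_n=\sum_{k=1}^nW_k$, $N_t=\sum_{n\ge1}\mathbb 1_{\{T_n\le t\}}$, $S_t=\sum_{n=1}^{N_t}X_n$, $J_t=t-T_{N_t}$ and $V_t=T_{N_t+1}-t$ for $t\ge0$. On the event $\{N_t=\infty\}$, which is null under every measure that makes $(W_n)$ i.i.d., $N_t$ is replaced by $0$ in $J_t$, $V_t$ and in the sums $S^{(\gamma)}_t$, $T^{(\delta)}_{N_t}$, $T^{(\delta)}_{N_t+1}$ below. Let $\mathcal F=(\mathcal F_t)_{t\ge0}$ be the natural filtration of $S$ and $\mathcal H_t=\sigma\big(\mathcal F_t\cup\sigma(V_u:u\le t)\big)$. For a probability measure $Q$ on $\Sigma$, $S$ is a $Q$-compound renewal process if under $Q$ the sequence $(W_n)$ is i.i.d.,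 the sequence $(X_n)$ is i.i.d., and $(X_n)_{n\ge 1}$ and $(N_t)_{t\ge0}$ are independent. Let $\mathcal M$ be the set of all probability measures $Q$ on $\Sigma$ such that $S$ is a $Q$-compound renewal process and, for every $t\ge0$, $Q$ and $P$ have the same null sets in $\mathcal H_t$. Let $\mathcal A$ be the set of all pairs $(\gamma,\delta)$ of Borel functions $(0,\infty)\to\mathbb R$ with $\mathbb E_P[e^{\gamma(X_1)}]=\mathbb E_P[e^{\delta(W_1)}]=1$. For $(\gamma,\delta)\in\mathcal A$ and $t\ge 0$ put $S^{(\gamma)}_t=\sum_{j=1}^{N_t}\gamma(X_j)$, $T^{(\delta)}_{n}=\sum_{j=1}^{n}\delta(W_j)$, $$L^{(\gamma,\delta)}_t=e^{S_t^{(\gamma)}+T^{(\delta)}_{N_t+1}},\qquad M^{(\gamma,\delta)}_t=e^{S_t^{(\gamma)}+T^{(\delta)}_{N_t}}\cdot\frac{\int_{(J_t,\infty)}e^{\delta(w)}\,P_{W_1}(dw)}{\int_{(J_t,\infty)}P_{W_1}(dw)} .$$ (i) For every $Q\in\mathcal M$ there is a pair $(\gamma,\delta)\in\mathcal A$ such that,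 for all $t\ge0$, $$\frac{d(Q|_{\mathcal H_t})}{d(P|_{\mathcal H_t})}=L^{(\gamma,\delta)}_t\quad\text{and}\quad \frac{d(Q|_{\mathcal F_t})}{d(P|_{\mathcal F_t})}=M^{(\gamma,\delta)}_t\qquad P\text{-a.s.},$$ and $L^{(\gamma,\delta)}$ and $M^{(\gamma,\delta)}$ are a.s. positive $(P,\mathcal H)$- and $(P,\mathcal F)$-martingales, respectively, with $\mathbb E_P[L^{(\gamma,\delta)}_t]=\mathbb E_P[M^{(\gamma,\delta)}_t]=1$ for all $t$. The pair is essentially unique: a pair $(\gamma',\delta')\in\mathcal A$ satisfies $d(Q|_{\mathcal H_t})/d(P|_{\mathcal H_t})=L^{(\gamma',\delta')}_t$ $P$-a.s. for all $t\ge0$ if and only if $\gamma'=\gamma$ $P_{X_1}$-a.s. and $\delta'=\delta$ $P_{W_1}$-a.s. (ii) Conversely, for every $(\gamma,\delta)\in\mathcal A$ there is a unique probability measure $Q$ on $\Sigma$ with $$Q(A)=\mathbb E_P\big[\mathbb 1_A\,L^{(\gamma,\delta)}_t\big]\quad\text{for all }t\ge0\text{ and }A\in\mathcal H_t .$$ This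 $Q$ belongs to $\mathcal M$ and satisfies $d(Q|_{\mathcal F_t})/d(P|_{\mathcal F_t})=M^{(\gamma,\delta)}_t$ $P$-a.s. for all $t\ge0$. -/

import Mathlib

open MeasureTheory ProbabilityTheory
open scoped NNReal ENNReal

noncomputable section

namespace CompoundRenewal

/-- The set `(0, ∞)`, with its Borel σ-algebra. -/
abbrev Pos : Type := Set.Ioi (0 : ℝ)

/-- The canonical space `(0,∞)^ℕ × (0,∞)^ℕ` with its product (= Borel) σ-algebra; the first factor
carries the interarrival times, the second one the claim sizes. -/
abbrev ClaimSpace : Type := (ℕ → Pos) × (ℕ → Pos)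

/-- `P = μ^{⊗ℕ} ⊗ ν^{⊗ℕ}`. -/
def canonicalMeasure (μ ν : Measure Pos) [IsProbabilityMeasure μ] [IsProbabilityMeasure ν] :
    Measure ClaimSpace :=
  (Measure.infinitePi fun _ : ℕ => μ).prod (Measure.infinitePi fun _ : ℕ => ν)

/-- The interarrival times; `interarrival n` is `W_{n+1}`. -/
def interarrival (n : ℕ) (ω : ClaimSpace) : Pos := ω.1 n

/-- The claim sizes; `claimSize n` is `X_{n+1}`. -/
def claimSize (n : ℕ) (ω : ClaimSpace) : Pos := ω.2 n

/-- The arrival times `T_n = W_1 + ... + W_n`, with `T_0 = 0`. -/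
def arrival (n : ℕ) (ω : ClaimSpace) : ℝ := ∑ k ∈ Finset.range n, (interarrival k ω : ℝ)

/-- The claim number `N_t = ∑_{n ≥ 1} 1_{T_n ≤ t}`, with value `∞` after an explosion. -/
def claimNumber (t : ℝ≥0) (ω : ClaimSpace) : ℕ∞ := {n : ℕ | arrival (n + 1) ω ≤ t}.encard

/-- The aggregate claims `S_t = ∑_{n=1}^{N_t} X_n` (an infinite series after an explosion). -/
def aggregateClaims (t : ℝ≥0) (ω : ClaimSpace) : ℝ≥0∞ :=
  ∑' n : ℕ, if (n : ℕ∞) < claimNumber t ω then ENNReal.ofReal (claimSize n ω) else 0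

/-- `N_t` as a natural number. It differs from `claimNumber` only on the explosion event
`{N_t = ∞}`, where it is `0`; that event is null under every measure for which the interarrival
times are i.i.d., and it is the only place where `J_t`, `V_t` and the sums up to `N_t` below
need a convention. -/
def claimCount (t : ℝ≥0) (ω : ClaimSpace) : ℕ := (claimNumber t ω).toNat

/-- The backward recurrence time `J_t = t - T_{N_t}`. -/
def backwardTime (t : ℝ≥0) (ω : ClaimSpace) : ℝ := t - arrival (claimCount t ω) ω

/-- The forward recurrence time `V_t = T_{N_t + 1} - t`. -/
def forwardTime (t : ℝ≥0) (ω : ClaimSpace) : ℝ := arrival (claimCount t ω + 1) ω - t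

lemma measurable_interarrival (n : ℕ) : Measurable (interarrival n) :=
  (measurable_pi_apply n).comp measurable_fst

lemma measurable_claimSize (n : ℕ) : Measurable (claimSize n) :=
  (measurable_pi_apply n).comp measurable_snd

lemma measurable_arrival (n : ℕ) : Measurable (arrival n) :=
  Finset.measurable_sum _ fun k _ => measurable_subtype_coe.comp (measurable_interarrival k)

lemma arrival_strictMono (ω : ClaimSpace) : StrictMono fun n => arrival n ω :=
  strictMono_nat_of_lt_succ fun n => by
    simp only [arrival, Finset.sum_range_succ]
    exact lt_add_of_pos_right _ (interarrival n ω).2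

lemma lt_claimNumber_iff (n : ℕ) (t : ℝ≥0) (ω : ClaimSpace) :
    (n : ℕ∞) < claimNumber t ω ↔ arrival (n + 1) ω ≤ t := by
  have hmono := (arrival_strictMono ω).monotone
  constructor
  · intro h
    by_contra hn
    have hsub : {k : ℕ | arrival (k + 1) ω ≤ t} ⊆ (Finset.range n : Set ℕ) := by
      intro k hk
      simp only [Finset.coe_range, Set.mem_Iio]
      by_contra hkn
      exact hn ((hmono (by omega : n + 1 ≤ k + 1)).trans hk)
    have := Set.encard_le_encard hsub
    rw [Set.encard_coe_eq_coe_finsetCard, Finset.card_range] at this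
    exact absurd h (not_lt.mpr this)
  · intro h
    have hsub : (Finset.range (n + 1) : Set ℕ) ⊆ {k : ℕ | arrival (k + 1) ω ≤ t} := by
      intro k hk
      simp only [Finset.coe_range, Set.mem_Iio] at hk
      exact (hmono (by omega : k + 1 ≤ n + 1)).trans h
    have := Set.encard_le_encard hsub
    rw [Set.encard_coe_eq_coe_finsetCard, Finset.card_range] at this
    exact lt_of_lt_of_le (by exact_mod_cast Nat.lt_succ_self n) this

lemma measurable_aggregateClaims (t : ℝ≥0) : Measurable (aggregateClaims t) := by
  refine Measurable.tsum fun n => Measurable.ite ?_ ?_ measurable_const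
  · simp only [lt_claimNumber_iff]
    exact measurableSet_le (measurable_arrival _) measurable_const
  · exact ENNReal.measurable_ofReal.comp (measurable_subtype_coe.comp (measurable_claimSize n))

lemma measurable_claimNumber (t : ℝ≥0) : Measurable (claimNumber t) := by
  have h : ∀ n : ℕ, MeasurableSet {ω | (n : ℕ∞) < claimNumber t ω} := fun n => by
    simp only [lt_claimNumber_iff]
    exact measurableSet_le (measurable_arrival _) measurable_const
  refine measurable_to_countable' fun x => ?_
  have hx : claimNumber t ⁻¹' {x} =
      ⋂ n : ℕ, {ω | (n : ℕ∞) < claimNumber t ω ↔ (n : ℕ∞) < x} := by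
    ext ω
    simp only [Set.mem_preimage, Set.mem_singleton_iff, Set.mem_iInter, Set.mem_ofPred_eq]
    refine ⟨fun e n => by rw [e], fun e => ?_⟩
    refine le_antisymm (ENat.forall_natCast_le_iff_le.mp fun m hm => ?_)
      (ENat.forall_natCast_le_iff_le.mp fun m hm => ?_)
    all_goals
      cases m with
      | zero => simp
      | succ k =>
        have hk : (k : ℕ∞) < ((k + 1 : ℕ) : ℕ∞) := by exact_mod_cast Nat.lt_succ_self k
        rw [Nat.cast_succ]
        refine Order.add_one_le_of_lt ?_
        first
          | exact (e k).1 (hk.trans_le hm)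
          | exact (e k).2 (hk.trans_le hm)
  rw [hx]
  refine MeasurableSet.iInter fun n => ?_
  by_cases hn : (n : ℕ∞) < x
  · simpa [hn] using h n
  · simp only [hn, iff_false]
    exact (h n).compl

lemma measurable_forwardTime (t : ℝ≥0) : Measurable (forwardTime t) := by
  have h : Measurable (claimCount t) := measurable_from_top.comp (measurable_claimNumber t)
  have h' : Measurable fun ω => arrival (claimCount t ω + 1) ω :=
    (measurable_from_prod_countable_right (f := fun p : ℕ × ClaimSpace => arrival (p.1 + 1) p.2)
      fun n => measurable_arrival (n + 1)).comp (h.prodMk measurable_id)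
  exact h'.sub_const _

/-- The natural filtration of the aggregate claims process. -/
def filtrationF : Filtration ℝ≥0 (inferInstance : MeasurableSpace ClaimSpace) :=
  Filtration.natural aggregateClaims fun t => (measurable_aggregateClaims t).stronglyMeasurable

/-- The natural filtration of the forward recurrence time process. -/
def filtrationV : Filtration ℝ≥0 (inferInstance : MeasurableSpace ClaimSpace) :=
  Filtration.natural forwardTime fun t => (measurable_forwardTime t).stronglyMeasurable

/-- The enlarged filtration `H_t = σ(F_t ∪ F^V_t)`. -/
def filtrationH : Filtration ℝ≥0 (inferInstance : MeasurableSpace ClaimSpace) :=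
  filtrationF ⊔ filtrationV

/-- `S` is a compound renewal process under `Q`: the interarrival times are i.i.d., the claim sizes
are i.i.d., and the claim size process is independent of the claim number process. -/
structure IsCompoundRenewal (Q : Measure ClaimSpace) : Prop where
  indep_interarrival : iIndepFun interarrival Q
  ident_interarrival : ∀ n, IdentDistrib (interarrival n) (interarrival 0) Q Q
  indep_claimSize : iIndepFun claimSize Q
  ident_claimSize : ∀ n, IdentDistrib (claimSize n) (claimSize 0) Q Q
  indep_claimSize_claimNumber :
    IndepFun (fun ω (n : ℕ) => claimSize n ω) (fun ω (t : ℝ≥0) => claimNumber t ω) Q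

/-- `Q` and `P` have the same null sets in each σ-algebra of the filtration. -/
def ProgressivelyEquivalent (Q P : Measure ClaimSpace)
    (𝒢 : Filtration ℝ≥0 (inferInstance : MeasurableSpace ClaimSpace)) : Prop :=
  ∀ t : ℝ≥0, ∀ A : Set ClaimSpace, MeasurableSet[𝒢 t] A → (P A = 0 ↔ Q A = 0)

/-- The probability measures that are progressively equivalent to `P` on `H` and under which `S` is
a compound renewal process. -/
structure IsStructurePreserving (P Q : Measure ClaimSpace) : Prop where
  isProbabilityMeasure : IsProbabilityMeasure Q
  isCompoundRenewal : IsCompoundRenewal Q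
  progressivelyEquivalent : ProgressivelyEquivalent Q P filtrationH

/-- The pairs `(γ, δ)` of real-valued Borel functions on `(0, ∞)` with
`E_P[exp (γ X_1)] = E_P[exp (δ W_1)] = 1`. -/
structure IsAdmissiblePair (P : Measure ClaimSpace) (γ δ : Pos → ℝ) : Prop where
  measurable_fst : Measurable γ
  measurable_snd : Measurable δ
  integral_fst : ∫ ω, Real.exp (γ (claimSize 0 ω)) ∂P = 1
  integral_snd : ∫ ω, Real.exp (δ (interarrival 0 ω)) ∂P = 1

/-- `∑_{j=1}^{N_t} γ(X_j)`. -/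
def sumClaims (γ : Pos → ℝ) (t : ℝ≥0) (ω : ClaimSpace) : ℝ :=
  ∑ j ∈ Finset.range (claimCount t ω), γ (claimSize j ω)

/-- `∑_{j=1}^{n} δ(W_j)`. -/
def sumInterarrivals (δ : Pos → ℝ) (n : ℕ) (ω : ClaimSpace) : ℝ :=
  ∑ j ∈ Finset.range n, δ (interarrival j ω)

/-- `L_t = exp (∑_{j=1}^{N_t} γ(X_j) + ∑_{j=1}^{N_t+1} δ(W_j))`. -/
def processL (γ δ : Pos → ℝ) (t : ℝ≥0) (ω : ClaimSpace) : ℝ :=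
  Real.exp (sumClaims γ t ω + sumInterarrivals δ (claimCount t ω + 1) ω)

/-- `M_t = exp (∑_{j=1}^{N_t} γ(X_j) + ∑_{j=1}^{N_t} δ(W_j)) *
(∫_{(J_t,∞)} exp (δ w) P_{W_1}(dw)) / (∫_{(J_t,∞)} P_{W_1}(dw))`. -/
def processM (P : Measure ClaimSpace) (γ δ : Pos → ℝ) (t : ℝ≥0) (ω : ClaimSpace) : ℝ :=
  Real.exp (sumClaims γ t ω + sumInterarrivals δ (claimCount t ω) ω) *
    ((∫ w in {w : Pos | backwardTime t ω < (w : ℝ)}, Real.exp (δ w) ∂(P.map (interarrival 0))) /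
      (∫ _w in {w : Pos | backwardTime t ω < (w : ℝ)}, (1 : ℝ) ∂(P.map (interarrival 0))))

/-- For every `t`, the Radon-Nikodym derivative of `Q` restricted to `𝒢_t` with respect to `P`
restricted to `𝒢_t` is `Z_t`, almost surely for the restriction of `P` to `𝒢_t`. -/
def IsDensityProcess (Q P : Measure ClaimSpace)
    (𝒢 : Filtration ℝ≥0 (inferInstance : MeasurableSpace ClaimSpace)) (Z : ℝ≥0 → ClaimSpace → ℝ) : Prop :=
  ∀ t : ℝ≥0, @Measure.rnDeriv ClaimSpace (𝒢 t) (Q.trim (𝒢.le t)) (P.trim (𝒢.le t))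
    =ᵐ[P.trim (𝒢.le t)] fun ω => ENNReal.ofReal (Z t ω)

/-- `Z` is an almost surely positive `(P, 𝒢)`-martingale with mean `1`. -/
structure IsPositiveUnitMartingale (P : Measure ClaimSpace)
    (𝒢 : Filtration ℝ≥0 (inferInstance : MeasurableSpace ClaimSpace)) (Z : ℝ≥0 → ClaimSpace → ℝ) : Prop where
  martingale : Martingale Z 𝒢 P
  ae_pos : ∀ t, ∀ᵐ ω ∂P, 0 < Z t ω
  integral_eq_one : ∀ t, ∫ ω, Z t ω ∂P = 1

end CompoundRenewal

end

open CompoundRenewal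

/-! Everything reduces to product measures. The process `N` determines the interarrival times, so
under any measure making `S` a compound renewal process all coordinates are independent, and the
measure is `canonicalMeasure μ' ν'` for its two marginals (`IsCompoundRenewal.eq_canonicalMeasure`).
Equality of null sets on `filtrationH` makes `μ'`, `μ` and `ν'`, `ν` equivalent, and equivalent laws
have densities `exp δ` and `exp γ`.

The densities come from localizing on `{N_t = n}`. There an event of `H_t` depends only on `W_1,
..., W_{n+1}, X_1, ..., X_n`; the density of one product measure with respect to the other on these
coordinates is a finite product, which is `L_t` on that event. Summing over `n` loses nothing, since
explosions are null under both measures (`measure_eq_setLIntegral_processL`). An event of `F_t`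
depends, within `{N_t = n}`, only on the first `n` interarrival times and claims; about `W_{n+1}` it
is known only that it exceeds `J_t`. Integrating the independent `W_{n+1}` out of `L_t` turns its
last factor into the ratio of tail integrals in `M_t` (`measure_eq_setLIntegral_processM`).

The martingale properties are the consistency of these densities over time. Uniqueness holds because
the `F_t` together generate the whole σ-algebra: `L` determines `Q`, whose marginals determine `exp
γ` and `exp δ` almost everywhere. -/

noncomputable section

namespace CompoundRenewal

/-! ### Finite families of independent random variables with given marginal densities -/

section Density

variable {Ω ι β : Type*} [MeasurableSpace Ω] [MeasurableSpace β]

/-- If the `U i` are independent under `P` and under `Q` and the law of `U i` under `Q` has density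
`φ i` with respect to the one under `P`, then `∏ i ∈ s, φ i (U i)` is the density of `Q` with
respect to `P` on the σ-algebra generated by the `U i`, `i ∈ s`. -/
lemma measure_eq_setLIntegral_prod_of_iIndepFun {P Q : Measure Ω} {U : ι → Ω → β}
    (hU : ∀ i, Measurable (U i)) (hP : iIndepFun U P) (hQ : iIndepFun U Q)
    {φ : ι → β → ℝ≥0∞} (hφ : ∀ i, Measurable (φ i))
    (hlaw : ∀ i, Q.map (U i) = (P.map (U i)).withDensity (φ i)) (s : Finset ι) {A : Set Ω}
    (hA : MeasurableSet[MeasurableSpace.comap (fun ω (i : s) => U i ω) inferInstance] A) :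
    Q A = ∫⁻ ω in A, ∏ i ∈ s, φ i (U i ω) ∂P := by
  have : IsProbabilityMeasure P := hP.isProbabilityMeasure
  have : IsProbabilityMeasure Q := hQ.isProbabilityMeasure
  have : ∀ i, IsProbabilityMeasure (Q.map (U i)) := fun i =>
    Measure.isProbabilityMeasure_map (hU i).aemeasurable
  have hmeas : Measurable (fun ω (i : s) => U i ω) := measurable_pi_lambda _ fun i => hU i
  have hY : Measurable fun ω => ∏ i ∈ s, φ i (U i ω) :=
    Finset.measurable_prod _ fun i _ => (hφ i).comp (hU i)
  -- Under `Q` the joint law is a product, so it is enough to compare boxes. The indicator of a box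
  -- is itself a product over coordinates, and independence under `P` factors the integral.
  have key : Q.map (fun ω (i : s) => U i ω) =
      (P.withDensity fun ω => ∏ i ∈ s, φ i (U i ω)).map (fun ω (i : s) => U i ω) := by
    have h1 : iIndepFun (fun (i : s) => U i) Q := hQ.precomp Subtype.val_injective
    rw [(iIndepFun_iff_map_fun_eq_pi_map (fun i : s => (hU i).aemeasurable)).1 h1]
    refine Measure.pi_eq fun B hB => ?_
    rw [Measure.map_apply hmeas (.univ_pi hB), withDensity_apply _ (hmeas (.univ_pi hB)),
      ← lintegral_indicator (hmeas (.univ_pi hB))]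
    have h2 : ∀ ω, ((fun ω (i : s) => U i ω) ⁻¹' Set.univ.pi B).indicator
        (fun ω => ∏ i ∈ s, φ i (U i ω)) ω = ∏ i : s, (B i).indicator (φ i) (U i ω) := by
      intro ω
      by_cases h : ω ∈ (fun ω (i : s) => U i ω) ⁻¹' Set.univ.pi B
      · rw [Set.indicator_of_mem h, ← Finset.prod_coe_sort s (fun i => φ i (U i ω))]
        refine Finset.prod_congr rfl fun i _ => ?_
        rw [Set.indicator_of_mem (h i (Set.mem_univ i))]
      · rw [Set.indicator_of_notMem h]
        simp only [Set.mem_preimage, Set.mem_univ_pi, not_forall] at h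
        obtain ⟨i, hi⟩ := h
        exact (Finset.prod_eq_zero (Finset.mem_univ i) (Set.indicator_of_notMem hi _)).symm
    simp_rw [h2]
    have h3 : iIndepFun (fun (i : s) => U i) P := hP.precomp Subtype.val_injective
    have h4 := h3.comp (fun (i : s) => (B i).indicator (φ i)) fun i => (hφ i).indicator (hB i)
    have h5 := lintegral_prod_eq_prod_lintegral_of_indepFun Finset.univ _ h4
      fun i => ((hφ i).indicator (hB i)).comp (hU i)
    simp only [Function.comp_apply] at h5
    rw [h5]
    refine Finset.prod_congr rfl fun i _ => ?_
    rw [hlaw, withDensity_apply _ (hB i), ← lintegral_indicator (hB i),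
      lintegral_map ((hφ i).indicator (hB i)) (hU i)]
  obtain ⟨B, hB, rfl⟩ := hA
  rw [← Measure.map_apply hmeas hB, key, Measure.map_apply hmeas hB,
    withDensity_apply _ (hmeas hB)]

end Density

/-! ### The canonical measure -/

/-- The joint family of all interarrival times and claim sizes. -/
def coordinate : ℕ ⊕ ℕ → ClaimSpace → Pos := Sum.elim interarrival claimSize

lemma measurable_coordinate (i : ℕ ⊕ ℕ) : Measurable (coordinate i) := by
  cases i with
  | inl n => exact measurable_interarrival n
  | inr n => exact measurable_claimSize n

section Canonical

variable (μ ν : Measure Pos) [IsProbabilityMeasure μ] [IsProbabilityMeasure ν]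

instance : IsProbabilityMeasure (canonicalMeasure μ ν) := by
  unfold canonicalMeasure; infer_instance

lemma map_interarrival (n : ℕ) : (canonicalMeasure μ ν).map (interarrival n) = μ := by
  have : interarrival n = (fun w : ℕ → Pos => w n) ∘ Prod.fst := rfl
  rw [this, ← Measure.map_map (measurable_pi_apply n) measurable_fst, canonicalMeasure,
    Measure.map_fst_prod, measure_univ, one_smul]
  exact Measure.infinitePi_map_eval (fun _ => μ) n

lemma map_claimSize (n : ℕ) : (canonicalMeasure μ ν).map (claimSize n) = ν := by
  have : claimSize n = (fun w : ℕ → Pos => w n) ∘ Prod.snd := rfl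
  rw [this, ← Measure.map_map (measurable_pi_apply n) measurable_snd, canonicalMeasure,
    Measure.map_snd_prod, measure_univ, one_smul]
  exact Measure.infinitePi_map_eval (fun _ => ν) n

lemma map_coordinate (i : ℕ ⊕ ℕ) :
    (canonicalMeasure μ ν).map (coordinate i) = Sum.elim (fun _ => μ) (fun _ => ν) i := by
  cases i with
  | inl n => exact map_interarrival μ ν n
  | inr n => exact map_claimSize μ ν n

/-- A cylinder over finitely many mixed indices is a rectangle with one cylinder in each factor. -/
lemma iIndepFun_coordinate : iIndepFun coordinate (canonicalMeasure μ ν) := by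
  rw [iIndepFun_iff_measure_inter_preimage_eq_mul]
  intro S B hB
  have h1 : (⋂ i ∈ S, coordinate i ⁻¹' B i) =
      ((S.toLeft : Set ℕ).pi fun n => B (.inl n)) ×ˢ
        ((S.toRight : Set ℕ).pi fun n => B (.inr n)) := by
    ext ω
    simp [coordinate, interarrival, claimSize, Set.mem_pi]
  have h2 : ∀ i ∈ S, canonicalMeasure μ ν (coordinate i ⁻¹' B i) =
      Sum.elim (fun _ => μ) (fun _ => ν) i (B i) := fun i hi => by
    rw [← map_coordinate μ ν i, Measure.map_apply (measurable_coordinate i) (hB i hi)]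
  rw [Finset.prod_congr rfl h2, h1, canonicalMeasure, Measure.prod_prod,
    Measure.infinitePi_pi, Measure.infinitePi_pi,
    Finset.prod_sum_eq_prod_toLeft_mul_prod_toRight]
  · rfl
  · intro n hn
    exact hB _ (by simpa using hn)
  · intro n hn
    exact hB _ (by simpa using hn)

lemma iIndepFun_interarrival : iIndepFun interarrival (canonicalMeasure μ ν) :=
  (iIndepFun_coordinate μ ν).precomp (g := Sum.inl) Sum.inl_injective

lemma iIndepFun_claimSize : iIndepFun claimSize (canonicalMeasure μ ν) :=
  (iIndepFun_coordinate μ ν).precomp (g := Sum.inr) Sum.inr_injective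

lemma exists_measurable_claimNumber_eq_fst (t : ℝ≥0) :
    ∃ f : (ℕ → Pos) → ℕ∞, Measurable f ∧ ∀ ω, claimNumber t ω = f ω.1 := by
  -- The claim sizes are filled in with the constant `1`; `claimNumber` never reads them.
  refine ⟨fun w => claimNumber t (w, fun _ => ⟨1, Set.mem_Ioi.2 one_pos⟩),
    (measurable_claimNumber t).comp (by fun_prop), fun ω => rfl⟩

lemma isCompoundRenewal_canonicalMeasure : IsCompoundRenewal (canonicalMeasure μ ν) where
  indep_interarrival := iIndepFun_interarrival μ ν
  ident_interarrival n := ⟨(measurable_interarrival n).aemeasurable,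
    (measurable_interarrival 0).aemeasurable, by rw [map_interarrival, map_interarrival]⟩
  indep_claimSize := iIndepFun_claimSize μ ν
  ident_claimSize n := ⟨(measurable_claimSize n).aemeasurable,
    (measurable_claimSize 0).aemeasurable, by rw [map_claimSize, map_claimSize]⟩
  indep_claimSize_claimNumber := by
    choose f hf hfe using exists_measurable_claimNumber_eq_fst
    have h := (indepFun_prod (μ := Measure.infinitePi fun _ : ℕ => μ)
      (ν := Measure.infinitePi fun _ : ℕ => ν) (X := fun w t => f t w) (Y := id)
      (measurable_pi_lambda _ hf) measurable_id).symm
    simp only [← hfe] at h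
    exact h

end Canonical

/-- The interarrival times are determined by the claim number process. -/
lemma comap_interarrival_le_comap_claimNumber :
    MeasurableSpace.comap (fun ω (n : ℕ) => interarrival n ω) inferInstance ≤
      MeasurableSpace.comap (fun ω (t : ℝ≥0) => claimNumber t ω) inferInstance := by
  rw [← measurable_iff_comap_le]
  let m : MeasurableSpace ClaimSpace :=
    MeasurableSpace.comap (fun ω (t : ℝ≥0) => claimNumber t ω) inferInstance
  have hN : ∀ t, Measurable[m] (claimNumber t) := fun t =>
    (measurable_pi_apply t).comp (comap_measurable fun ω (t : ℝ≥0) => claimNumber t ω)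
  have hT : ∀ n, Measurable[m] (arrival n) := by
    intro n
    cases n with
    | zero =>
      have : arrival 0 = fun _ => 0 := by ext ω; simp [arrival]
      rw [this]
      exact measurable_const
    | succ n =>
      -- For `x ≥ 0` the event `T_{n+1} ≤ x` is `N_x > n`; for `x < 0` it is empty because arrival
      -- times are nonnegative.
      refine measurable_of_Iic fun x => ?_
      by_cases hx : 0 ≤ x
      · have : arrival (n + 1) ⁻¹' Set.Iic x = claimNumber ⟨x, hx⟩ ⁻¹' Set.Ioi (n : ℕ∞) := by
          ext ω
          exact (lt_claimNumber_iff n ⟨x, hx⟩ ω).symm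
        rw [this]
        exact hN _ (.of_discrete)
      · have : arrival (n + 1) ⁻¹' Set.Iic x = ∅ := by
          ext ω
          have h0 := (arrival_strictMono ω).monotone (Nat.zero_le (n + 1))
          simp only [arrival, Finset.range_zero, Finset.sum_empty] at h0
          simp only [Set.mem_preimage, Set.mem_Iic, Set.mem_empty_iff_false, iff_false, not_le,
            arrival]
          exact (not_le.1 hx).trans_le h0
        rw [this]
        exact MeasurableSet.empty
  refine @measurable_pi_lambda _ _ _ m _ _ fun n => ?_
  have : (fun ω => (interarrival n ω : ℝ)) = fun ω => arrival (n + 1) ω - arrival n ω := by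
    ext ω; simp [arrival, Finset.sum_range_succ]
  have h2 : Measurable[m] fun ω => (interarrival n ω : ℝ) := by
    rw [this]; exact (hT (n + 1)).sub (hT n)
  exact h2.subtype_mk (h := fun ω => (interarrival n ω).2)

/-- A measure that makes `S` a compound renewal process is a canonical measure. -/
lemma IsCompoundRenewal.eq_canonicalMeasure {Q : Measure ClaimSpace} (hQ : IsCompoundRenewal Q)
    (μ' ν' : Measure Pos) [IsProbabilityMeasure μ'] [IsProbabilityMeasure ν']
    (hμ : Q.map (interarrival 0) = μ') (hν : Q.map (claimSize 0) = ν') :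
    Q = canonicalMeasure μ' ν' := by
  have : IsProbabilityMeasure Q := hQ.indep_interarrival.isProbabilityMeasure
  have h1 : IndepFun (fun ω (n : ℕ) => claimSize n ω) (fun ω (n : ℕ) => interarrival n ω) Q :=
    indep_of_indep_of_le_right hQ.indep_claimSize_claimNumber
      comap_interarrival_le_comap_claimNumber
  have h2 := (indepFun_iff_map_prod_eq_prod_map_map
    (measurable_pi_lambda _ measurable_interarrival).aemeasurable
    (measurable_pi_lambda _ measurable_claimSize).aemeasurable).1 h1.symm
  rw [hQ.indep_interarrival.map_fun_eq_infinitePi_map measurable_interarrival,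
    hQ.indep_claimSize.map_fun_eq_infinitePi_map measurable_claimSize] at h2
  simp only [fun n => (hQ.ident_interarrival n).map_eq, fun n => (hQ.ident_claimSize n).map_eq,
    hμ, hν] at h2
  rw [canonicalMeasure, ← h2]
  exact Measure.map_id.symm

/-! ### Path properties -/

@[simp]
lemma arrival_zero (ω : ClaimSpace) : arrival 0 ω = 0 := by simp [arrival]

lemma arrival_succ (n : ℕ) (ω : ClaimSpace) :
    arrival (n + 1) ω = arrival n ω + interarrival n ω := Finset.sum_range_succ _ _

lemma arrival_nonneg (n : ℕ) (ω : ClaimSpace) : 0 ≤ arrival n ω := by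
  simpa using (arrival_strictMono ω).monotone (Nat.zero_le n)

lemma arrival_lt_succ (n : ℕ) (ω : ClaimSpace) : arrival n ω < arrival (n + 1) ω :=
  arrival_strictMono ω (Nat.lt_succ_self n)

lemma coe_le_claimNumber_iff (n : ℕ) (t : ℝ≥0) (ω : ClaimSpace) :
    (n : ℕ∞) ≤ claimNumber t ω ↔ arrival n ω ≤ t := by
  cases n with
  | zero => simp
  | succ n => rw [← lt_claimNumber_iff, Nat.cast_succ, ENat.add_one_le_iff (ENat.natCast_ne_top n)]

lemma claimNumber_eq_coe_iff (n : ℕ) (t : ℝ≥0) (ω : ClaimSpace) :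
    claimNumber t ω = n ↔ arrival n ω ≤ t ∧ (t : ℝ) < arrival (n + 1) ω := by
  rw [← coe_le_claimNumber_iff, ← not_le, ← lt_claimNumber_iff, not_lt]
  exact ⟨fun h => ⟨h.ge, h.le⟩, fun h => le_antisymm h.2 h.1⟩

lemma claimCount_of_claimNumber_eq {n : ℕ} {t : ℝ≥0} {ω : ClaimSpace}
    (h : claimNumber t ω = n) : claimCount t ω = n := by
  simp [claimCount, h]

lemma arrival_succ_le_of_lt_claimCount {j : ℕ} {t : ℝ≥0} {ω : ClaimSpace}
    (h : j < claimCount t ω) : arrival (j + 1) ω ≤ t := by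
  rw [← lt_claimNumber_iff]
  unfold claimCount at h
  cases hN : claimNumber t ω with
  | top => exact ENat.natCast_lt_top j
  | coe n =>
    rw [hN, ENat.toNat_natCast] at h
    exact_mod_cast h

/-- There is no exceptional set: after an explosion the count is `0` and `T_0 = 0 ≤ t`. -/
lemma arrival_claimCount_le (t : ℝ≥0) (ω : ClaimSpace) : arrival (claimCount t ω) ω ≤ t := by
  cases h : claimCount t ω with
  | zero => simp
  | succ n => exact arrival_succ_le_of_lt_claimCount (h ▸ Nat.lt_succ_self n)

lemma forwardTime_add_backwardTime (t : ℝ≥0) (ω : ClaimSpace) :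
    forwardTime t ω + backwardTime t ω = interarrival (claimCount t ω) ω := by
  rw [forwardTime, backwardTime, arrival_succ]; ring

lemma aggregateClaims_eq_tsum (t : ℝ≥0) (ω : ClaimSpace) :
    aggregateClaims t ω =
      ∑' n : ℕ, if arrival (n + 1) ω ≤ t then ENNReal.ofReal (claimSize n ω) else 0 := by
  simp only [aggregateClaims, lt_claimNumber_iff]

/-- The sum of the first `n` claim sizes. -/
def claimSum (n : ℕ) (ω : ClaimSpace) : ℝ≥0∞ :=
  ∑ k ∈ Finset.range n, ENNReal.ofReal (claimSize k ω)

lemma claimSum_ne_top (n : ℕ) (ω : ClaimSpace) : claimSum n ω ≠ ∞ :=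
  ENNReal.sum_ne_top.2 fun _ _ => ENNReal.ofReal_ne_top

lemma claimSum_succ (n : ℕ) (ω : ClaimSpace) :
    claimSum (n + 1) ω = claimSum n ω + ENNReal.ofReal (claimSize n ω) :=
  Finset.sum_range_succ _ _

lemma aggregateClaims_of_claimNumber_eq {n : ℕ} {t : ℝ≥0} {ω : ClaimSpace}
    (h : claimNumber t ω = n) : aggregateClaims t ω = claimSum n ω := by
  rw [aggregateClaims, h, tsum_eq_sum (s := Finset.range n), claimSum]
  · refine Finset.sum_congr rfl fun k hk => if_pos ?_
    exact_mod_cast Finset.mem_range.1 hk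
  · intro k hk
    refine if_neg ?_
    have := Finset.mem_range.not.1 hk
    exact_mod_cast this

lemma claimSum_le_aggregateClaims {n : ℕ} {t : ℝ≥0} {ω : ClaimSpace}
    (h : (n : ℕ∞) ≤ claimNumber t ω) : claimSum n ω ≤ aggregateClaims t ω := by
  refine le_trans (Finset.sum_le_sum fun k hk => ?_) (ENNReal.sum_le_tsum (Finset.range n))
  rw [if_pos]
  exact lt_of_lt_of_le (by exact_mod_cast Finset.mem_range.1 hk) h

/-- Claims are strictly positive, so `S` increases strictly at every arrival, and `S_s` is finite
when `N_s` is. Through this equivalence the filtration of `S` detects arrivals. -/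
lemma aggregateClaims_lt_iff (s t : ℝ≥0) (ω : ClaimSpace) :
    aggregateClaims s ω < aggregateClaims t ω ↔ claimNumber s ω < claimNumber t ω := by
  constructor
  · intro h
    by_contra hn
    refine absurd h (not_lt.2 ?_)
    refine ENNReal.tsum_le_tsum fun k => ?_
    split_ifs with h1 h2
    · exact le_rfl
    · exact absurd (h1.trans_le (not_lt.1 hn)) h2
    · exact zero_le
    · exact le_rfl
  · intro h
    cases hN : claimNumber s ω with
    | top => exact absurd h (by simp [hN])
    | coe n =>
      rw [aggregateClaims_of_claimNumber_eq hN]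
      rw [hN] at h
      have h' : ((n + 1 : ℕ) : ℕ∞) ≤ claimNumber t ω := by
        rw [Nat.cast_succ]; exact Order.add_one_le_of_lt h
      refine lt_of_lt_of_le ?_ (claimSum_le_aggregateClaims h')
      rw [claimSum_succ]
      refine ENNReal.lt_add_right (claimSum_ne_top n ω) ?_
      exact (ENNReal.ofReal_pos.2 (claimSize n ω).2).ne'

/-- A rational strictly between `T_n` and `T_{n+1}`, capped at `t`, is a time with exactly `n`
arrivals. It makes unions and suprema over times in `[0, t]` countable. -/
lemma exists_rat_claimNumber_eq {n : ℕ} {t : ℝ≥0} {ω : ClaimSpace} (h : arrival n ω ≤ t) :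
    ∃ q : ℚ, claimNumber (min (Real.toNNReal q) t) ω = n := by
  obtain ⟨q, h1, h2⟩ := exists_rat_btwn (arrival_lt_succ n ω)
  have h0 : (0 : ℝ) ≤ q := (arrival_nonneg n ω).trans h1.le
  refine ⟨q, (claimNumber_eq_coe_iff _ _ _).2 ?_⟩
  rw [NNReal.coe_min, Real.coe_toNNReal _ h0]
  exact ⟨le_min h1.le h, (min_le_left _ _).trans_lt h2⟩

/-! ### Measurability with respect to the filtrations -/

lemma measurable_comp_nat {Ω β : Type*} [MeasurableSpace Ω] [MeasurableSpace β] {c : Ω → ℕ}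
    (hc : Measurable c) {g : ℕ → Ω → β} (hg : ∀ n, Measurable (g n)) :
    Measurable fun ω => g (c ω) ω :=
  (measurable_from_prod_countable_right (f := fun p : ℕ × Ω => g p.1 p.2) hg).comp
    (hc.prodMk measurable_id)

lemma measurable_aggregateClaims_filtrationF {u t : ℝ≥0} (h : u ≤ t) :
    Measurable[filtrationF t] (aggregateClaims u) :=
  (comap_measurable (aggregateClaims u)).mono
    (le_iSup₂_of_le (f := fun j (_ : j ≤ t) =>
      MeasurableSpace.comap (aggregateClaims j) inferInstance) u h le_rfl) le_rfl

lemma measurable_forwardTime_filtrationH (t : ℝ≥0) :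
    Measurable[filtrationH t] (forwardTime t) :=
  (comap_measurable (forwardTime t)).mono
    ((le_iSup₂_of_le (f := fun j (_ : j ≤ t) =>
      MeasurableSpace.comap (forwardTime j) inferInstance) t le_rfl le_rfl).trans
        (le_sup_right : filtrationV t ≤ filtrationF t ⊔ filtrationV t)) le_rfl

lemma filtrationF_le_filtrationH (t : ℝ≥0) : filtrationF t ≤ filtrationH t :=
  (le_sup_left : filtrationF t ≤ filtrationF t ⊔ filtrationV t)

/-- Induction on `n`: arrival `n + 1` has occurred by `t` exactly when, from some capped rational
time with at least `n` arrivals, `S` increases strictly up to `t`. -/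
lemma measurableSet_arrival_le_self (n : ℕ) (t : ℝ≥0) :
    MeasurableSet[filtrationF t] {ω | arrival n ω ≤ t} := by
  induction n generalizing t with
  | zero => simp
  | succ n ih =>
    have : {ω | arrival (n + 1) ω ≤ t} = ⋃ q : ℚ,
        ({ω | arrival n ω ≤ (min (Real.toNNReal q) t : ℝ≥0)} ∩
          {ω | aggregateClaims (min (Real.toNNReal q) t) ω < aggregateClaims t ω}) := by
      ext ω
      simp only [Set.mem_ofPred_eq, Set.mem_iUnion, Set.mem_inter_iff, aggregateClaims_lt_iff,
        ← coe_le_claimNumber_iff n, ← lt_claimNumber_iff]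
      constructor
      · intro h
        obtain ⟨q, hq⟩ := exists_rat_claimNumber_eq ((coe_le_claimNumber_iff n t ω).1 h.le)
        exact ⟨q, hq.ge, hq ▸ h⟩
      · rintro ⟨q, h1, h2⟩
        exact h1.trans_lt h2
    rw [this]
    refine MeasurableSet.iUnion fun q => ?_
    refine MeasurableSet.inter (filtrationF.mono (min_le_right _ _) _ (ih _)) ?_
    exact measurableSet_lt (measurable_aggregateClaims_filtrationF (min_le_right _ _))
      (measurable_aggregateClaims_filtrationF le_rfl)

lemma measurableSet_arrival_le (n : ℕ) {u t : ℝ≥0} (h : u ≤ t) :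
    MeasurableSet[filtrationF t] {ω | arrival n ω ≤ u} :=
  filtrationF.mono h _ (measurableSet_arrival_le_self n u)

lemma measurableSet_claimNumber_eq (n : ℕ) {u t : ℝ≥0} (h : u ≤ t) :
    MeasurableSet[filtrationF t] {ω | claimNumber u ω = n} := by
  simp only [claimNumber_eq_coe_iff, ← not_le]
  exact (measurableSet_arrival_le n h).inter (measurableSet_arrival_le (n + 1) h).compl

lemma measurable_claimNumber_filtrationF (t : ℝ≥0) : Measurable[filtrationF t] (claimNumber t) := by
  refine @measurable_to_countable' _ _ _ _ (filtrationF t) _ fun x => ?_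
  cases x with
  | coe n => exact measurableSet_claimNumber_eq n le_rfl
  | top =>
    have : claimNumber t ⁻¹' {⊤} = ⋂ n : ℕ, {ω | arrival n ω ≤ t} := by
      ext ω
      simp only [Set.mem_preimage, Set.mem_singleton_iff, Set.mem_iInter, Set.mem_ofPred_eq,
        ← coe_le_claimNumber_iff]
      refine ⟨fun h n => h ▸ le_top, fun h => ?_⟩
      exact ENat.eq_top_iff_forall_ge.2 h
    rw [this]
    exact MeasurableSet.iInter fun n => measurableSet_arrival_le n le_rfl

lemma measurable_claimCount_filtrationF (t : ℝ≥0) : Measurable[filtrationF t] (claimCount t) :=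
  (Measurable.of_discrete (f := ENat.toNat)).comp (measurable_claimNumber_filtrationF t)

/-- The cap at `t` matters: an arrival time beyond `t` need not be known at time `t`. -/
lemma measurable_min_arrival (n : ℕ) (t : ℝ≥0) :
    Measurable[filtrationF t] fun ω => min (arrival n ω) t := by
  refine @measurable_of_Iic _ _ _ _ _ (filtrationF t) _ _ _ _ fun x => ?_
  by_cases hx : (t : ℝ) ≤ x
  · convert MeasurableSet.univ
    ext ω
    simp [hx]
  · by_cases h0 : 0 ≤ x
    · have : (fun ω => min (arrival n ω) t) ⁻¹' Set.Iic x = {ω | arrival n ω ≤ (⟨x, h0⟩ : ℝ≥0)} := by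
        ext ω
        simp [hx]
      rw [this]
      exact measurableSet_arrival_le n (by exact_mod_cast (not_le.1 hx).le)
    · convert MeasurableSet.empty
      ext ω
      simp [(not_le.1 h0).trans_le (arrival_nonneg n ω), not_le.1 hx]

lemma measurable_claimSum_filtrationF (n : ℕ) (t : ℝ≥0) :
    Measurable[filtrationF t] fun ω => if arrival n ω ≤ t then claimSum n ω else 0 := by
  -- While `N = n`, `S` stays at the sum of the first `n` claims, so all terms of the supremum are
  -- that sum or `0`.
  have : (fun ω => if arrival n ω ≤ t then claimSum n ω else 0) = fun ω => ⨆ q : ℚ,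
      if claimNumber (min (Real.toNNReal q) t) ω = n
        then aggregateClaims (min (Real.toNNReal q) t) ω else 0 := by
    ext ω
    refine le_antisymm ?_ (iSup_le fun q => ?_)
    · split_ifs with h
      · obtain ⟨q, hq⟩ := exists_rat_claimNumber_eq h
        refine le_iSup_of_le q ?_
        rw [if_pos hq, aggregateClaims_of_claimNumber_eq hq]
      · exact zero_le
    · split_ifs with h1 h2
      · exact (aggregateClaims_of_claimNumber_eq h1).le
      · refine absurd (((claimNumber_eq_coe_iff _ _ _).1 h1).1.trans ?_) h2
        exact_mod_cast min_le_right _ _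
      · exact zero_le
      · exact le_rfl
  rw [this]
  refine Measurable.iSup fun q => Measurable.ite ?_ ?_ measurable_const
  · exact measurableSet_claimNumber_eq n (min_le_right _ _)
  · exact measurable_aggregateClaims_filtrationF (min_le_right _ _)

/-- The claim size `X_{n+1}` if it has occurred up to time `t`, and `1` otherwise. -/
def observedClaim (n : ℕ) (t : ℝ≥0) (ω : ClaimSpace) : Pos :=
  if arrival (n + 1) ω ≤ t then claimSize n ω else ⟨1, Set.mem_Ioi.2 one_pos⟩

/-- The interarrival time `W_{n+1}` if it has elapsed up to time `t`, and `1` otherwise. -/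
def observedInterarrival (n : ℕ) (t : ℝ≥0) (ω : ClaimSpace) : Pos :=
  if arrival (n + 1) ω ≤ t then interarrival n ω else ⟨1, Set.mem_Ioi.2 one_pos⟩

lemma measurable_observedClaim (n : ℕ) (t : ℝ≥0) :
    Measurable[filtrationF t] (observedClaim n t) := by
  have : (fun ω => (observedClaim n t ω : ℝ)) = fun ω => if arrival (n + 1) ω ≤ t then
      ((if arrival (n + 1) ω ≤ t then claimSum (n + 1) ω else 0) -
        (if arrival n ω ≤ t then claimSum n ω else 0)).toReal else 1 := by
    ext ω
    unfold observedClaim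
    split_ifs with h1 h2
    · rw [claimSum_succ, ENNReal.add_sub_cancel_left (claimSum_ne_top n ω),
        ENNReal.toReal_ofReal (claimSize n ω).2.le]
    · exact absurd ((arrival_lt_succ n ω).le.trans h1) h2
    · rfl
  have h2 : Measurable[filtrationF t] fun ω => (observedClaim n t ω : ℝ) := by
    rw [this]
    refine Measurable.ite (measurableSet_arrival_le _ le_rfl) ?_ measurable_const
    exact ((measurable_claimSum_filtrationF (n + 1) t).sub
      (measurable_claimSum_filtrationF n t)).ennreal_toReal
  exact h2.subtype_mk (h := fun ω => (observedClaim n t ω).2)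

lemma measurable_observedInterarrival (n : ℕ) (t : ℝ≥0) :
    Measurable[filtrationF t] (observedInterarrival n t) := by
  have : (fun ω => (observedInterarrival n t ω : ℝ)) = fun ω => if arrival (n + 1) ω ≤ t then
      (min (arrival (n + 1) ω) t - min (arrival n ω) t) else 1 := by
    ext ω
    unfold observedInterarrival
    split_ifs with h1
    · rw [min_eq_left h1, min_eq_left ((arrival_lt_succ n ω).le.trans h1), arrival_succ]
      ring
    · rfl
  have h2 : Measurable[filtrationF t] fun ω => (observedInterarrival n t ω : ℝ) := by
    rw [this]
    refine Measurable.ite (measurableSet_arrival_le _ le_rfl) ?_ measurable_const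
    exact (measurable_min_arrival (n + 1) t).sub (measurable_min_arrival n t)
  exact h2.subtype_mk (h := fun ω => (observedInterarrival n t ω).2)

lemma measurable_backwardTime_filtrationF (t : ℝ≥0) :
    Measurable[filtrationF t] (backwardTime t) := by
  have : backwardTime t = fun ω => (t : ℝ) - min (arrival (claimCount t ω) ω) t := by
    ext ω
    rw [backwardTime, min_eq_left (arrival_claimCount_le t ω)]
  rw [this]
  exact (@measurable_comp_nat _ _ (filtrationF t) _ _ (measurable_claimCount_filtrationF t)
    (fun n ω => min (arrival n ω) t) fun n => measurable_min_arrival n t).const_sub _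

/-- Only claims that have occurred by `t` enter the sum, so each may be replaced by its
`observedClaim`. -/
lemma measurable_sumClaims_filtrationF {γ : Pos → ℝ} (hγ : Measurable γ) (t : ℝ≥0) :
    Measurable[filtrationF t] (sumClaims γ t) := by
  have : sumClaims γ t = fun ω =>
      ∑ j ∈ Finset.range (claimCount t ω), γ (observedClaim j t ω) := by
    ext ω
    refine Finset.sum_congr rfl fun j hj => ?_
    rw [observedClaim, if_pos (arrival_succ_le_of_lt_claimCount (Finset.mem_range.1 hj))]
  rw [this]
  exact @measurable_comp_nat _ _ (filtrationF t) _ _ (measurable_claimCount_filtrationF t)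
    (fun n ω => ∑ j ∈ Finset.range n, γ (observedClaim j t ω)) fun n =>
      Finset.measurable_sum _ fun j _ => hγ.comp (measurable_observedClaim j t)

lemma measurable_sumInterarrivals_filtrationF {δ : Pos → ℝ} (hδ : Measurable δ) (t : ℝ≥0) :
    Measurable[filtrationF t] fun ω => sumInterarrivals δ (claimCount t ω) ω := by
  have : (fun ω => sumInterarrivals δ (claimCount t ω) ω) = fun ω =>
      ∑ j ∈ Finset.range (claimCount t ω), δ (observedInterarrival j t ω) := by
    ext ω
    refine Finset.sum_congr rfl fun j hj => ?_
    rw [observedInterarrival, if_pos (arrival_succ_le_of_lt_claimCount (Finset.mem_range.1 hj))]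
  rw [this]
  exact @measurable_comp_nat _ _ (filtrationF t) _ _ (measurable_claimCount_filtrationF t)
    (fun n ω => ∑ j ∈ Finset.range n, δ (observedInterarrival j t ω)) fun n =>
      Finset.measurable_sum _ fun j _ => hδ.comp (measurable_observedInterarrival j t)

lemma measurable_processL {γ δ : Pos → ℝ} (hγ : Measurable γ) (hδ : Measurable δ) (t : ℝ≥0) :
    Measurable[filtrationH t] (processL γ δ t) := by
  have hle := filtrationF_le_filtrationH t
  -- The running interarrival time `W_{N_t+1}` is `V_t + J_t`; this is the information that
  -- `filtrationH` adds to `filtrationF`.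
  have hW : Measurable[filtrationH t] fun ω => interarrival (claimCount t ω) ω := by
    have h2 : Measurable[filtrationH t] fun ω => (interarrival (claimCount t ω) ω : ℝ) := by
      simp only [← forwardTime_add_backwardTime]
      exact (measurable_forwardTime_filtrationH t).add
        ((measurable_backwardTime_filtrationF t).mono hle le_rfl)
    exact h2.subtype_mk (h := fun ω => (interarrival (claimCount t ω) ω).2)
  have : processL γ δ t = fun ω => Real.exp (sumClaims γ t ω +
      (sumInterarrivals δ (claimCount t ω) ω + δ (interarrival (claimCount t ω) ω))) := by
    ext ω
    rw [processL, sumInterarrivals, Finset.sum_range_succ, sumInterarrivals]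
  rw [this]
  exact Real.measurable_exp.comp (((measurable_sumClaims_filtrationF hγ t).mono hle le_rfl).add
    (((measurable_sumInterarrivals_filtrationF hδ t).mono hle le_rfl).add (hδ.comp hW)))

lemma measurable_setIntegral_tail {μ : Measure Pos} {f : Pos → ℝ} (hf : Integrable f μ)
    (h0 : ∀ w, 0 ≤ f w) : Measurable fun x : ℝ => ∫ w in {w : Pos | x < (w : ℝ)}, f w ∂μ := by
  refine Antitone.measurable fun x y hxy => ?_
  refine setIntegral_mono_set hf.integrableOn (ae_of_all _ h0) (ae_of_all _ fun w hw => ?_)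
  exact lt_of_le_of_lt hxy hw

lemma measurable_processM {P : Measure ClaimSpace} [IsProbabilityMeasure P] {γ δ : Pos → ℝ}
    (hγ : Measurable γ) (hδ : Measurable δ)
    (hint : Integrable (fun w => Real.exp (δ w)) (P.map (interarrival 0))) (t : ℝ≥0) :
    Measurable[filtrationF t] (processM P γ δ t) := by
  have : IsProbabilityMeasure (P.map (interarrival 0)) :=
    Measure.isProbabilityMeasure_map (measurable_interarrival 0).aemeasurable
  refine Measurable.mul ?_ (Measurable.div ?_ ?_)
  · exact Real.measurable_exp.comp ((measurable_sumClaims_filtrationF hγ t).add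
      (measurable_sumInterarrivals_filtrationF hδ t))
  · exact (measurable_setIntegral_tail hint fun _ => (Real.exp_pos _).le).comp
      (measurable_backwardTime_filtrationF t)
  · exact (measurable_setIntegral_tail (integrable_const 1) fun _ => zero_le_one).comp
      (measurable_backwardTime_filtrationF t)

/-! ### The filtration `F` exhausts the σ-algebra -/

/-- Every arrival time is finite, so along integer times the observed claims and interarrival times
are eventually equal to the true ones; the coordinates are pointwise limits. -/
lemma le_of_forall_filtrationF_le {m : MeasurableSpace ClaimSpace}
    (hm : ∀ t, filtrationF t ≤ m) : Prod.instMeasurableSpace ≤ m := by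
  have hX : ∀ n, Measurable[m] (claimSize n) := fun n => by
    refine @measurable_of_tendsto_metrizable _ _ m _ _ _ _ (fun k : ℕ => observedClaim n k)
      _ (fun k => (measurable_observedClaim n k).mono (hm _) le_rfl) ?_
    refine tendsto_pi_nhds.2 fun ω => tendsto_const_nhds.congr' ?_
    obtain ⟨k, hk⟩ := exists_nat_ge (arrival (n + 1) ω)
    filter_upwards [Filter.eventually_ge_atTop k] with j hj
    have : arrival (n + 1) ω ≤ ((j : ℝ≥0) : ℝ) := hk.trans (by exact_mod_cast hj)
    rw [observedClaim, if_pos this]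
  have hW : ∀ n, Measurable[m] (interarrival n) := fun n => by
    refine @measurable_of_tendsto_metrizable _ _ m _ _ _ _ (fun k : ℕ => observedInterarrival n k)
      _ (fun k => (measurable_observedInterarrival n k).mono (hm _) le_rfl) ?_
    refine tendsto_pi_nhds.2 fun ω => tendsto_const_nhds.congr' ?_
    obtain ⟨k, hk⟩ := exists_nat_ge (arrival (n + 1) ω)
    filter_upwards [Filter.eventually_ge_atTop k] with j hj
    have : arrival (n + 1) ω ≤ ((j : ℝ≥0) : ℝ) := hk.trans (by exact_mod_cast hj)
    rw [observedInterarrival, if_pos this]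
  have hW' : Measurable[m] fun ω (n : ℕ) => interarrival n ω := measurable_pi_lambda _ hW
  have hX' : Measurable[m] fun ω (n : ℕ) => claimSize n ω := measurable_pi_lambda _ hX
  exact fun s hs => (hW'.prodMk hX') hs

/-- Finite measures that agree on all `F_t` are equal. -/
lemma eq_of_forall_filtrationF {Q Q' : Measure ClaimSpace} [IsFiniteMeasure Q]
    (h : ∀ t : ℝ≥0, ∀ A, MeasurableSet[filtrationF t] A → Q A = Q' A) : Q = Q' := by
  refine ext_of_generate_finite {A | ∃ t, MeasurableSet[filtrationF t] A} ?_ ?_ ?_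
    (h 0 _ MeasurableSet.univ)
  · refine le_antisymm (le_of_forall_filtrationF_le fun t s hs => ?_)
      (MeasurableSpace.generateFrom_le ?_)
    · exact MeasurableSpace.measurableSet_generateFrom ⟨t, hs⟩
    · rintro s ⟨t, hs⟩
      exact filtrationF.le t s hs
  · rintro A ⟨s, hA⟩ B ⟨t, hB⟩ -
    exact ⟨max s t, (filtrationF.mono (le_max_left s t) _ hA).inter
      (filtrationF.mono (le_max_right s t) _ hB)⟩
  · rintro A ⟨t, hA⟩
    exact h t A hA

/-! ### Absence of explosions -/

lemma lintegral_exp_neg_lt_one (μ : Measure Pos) [IsProbabilityMeasure μ] :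
    ∫⁻ w, ENNReal.ofReal (Real.exp (-(w : ℝ))) ∂μ < 1 := by
  have h : ∀ w : Pos, ENNReal.ofReal (Real.exp (-(w : ℝ))) < 1 := fun w => by
    rw [← ENNReal.ofReal_one]
    refine (ENNReal.ofReal_lt_ofReal_iff one_pos).2 (Real.exp_lt_one_iff.2 ?_)
    exact neg_lt_zero.2 w.2
  have hle : ∫⁻ w, ENNReal.ofReal (Real.exp (-(w : ℝ))) ∂μ ≤ ∫⁻ _, 1 ∂μ :=
    lintegral_mono fun w => (h w).le
  have hlt := lintegral_strict_mono (μ := μ) (g := fun _ => (1 : ℝ≥0∞)) (NeZero.ne μ)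
    measurable_const.aemeasurable (ne_top_of_le_ne_top (by simp) hle) (ae_of_all _ h)
  simpa using hlt

/-- A Chernoff bound: on an explosion `T_n ≤ t` for every `n`, so `1 ≤ exp t * ∏ exp (-W_j)`. The
mean of the right side is `exp t * r ^ n`, with `r < 1` because interarrival times are positive. -/
lemma measure_claimNumber_eq_top (μ ν : Measure Pos) [IsProbabilityMeasure μ]
    [IsProbabilityMeasure ν] (t : ℝ≥0) : canonicalMeasure μ ν {ω | claimNumber t ω = ⊤} = 0 := by
  set r := ∫⁻ w, ENNReal.ofReal (Real.exp (-(w : ℝ))) ∂μ 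
  have hf : Measurable fun w : Pos => ENNReal.ofReal (Real.exp (-(w : ℝ))) := by fun_prop
  have hbound : ∀ n : ℕ, canonicalMeasure μ ν {ω | claimNumber t ω = ⊤} ≤
      ENNReal.ofReal (Real.exp t) * r ^ n := by
    intro n
    have h1 : ∫⁻ ω, ∏ j ∈ Finset.range n, ENNReal.ofReal (Real.exp (-(interarrival j ω : ℝ)))
        ∂(canonicalMeasure μ ν) = r ^ n := by
      have := lintegral_prod_eq_prod_lintegral_of_indepFun (Finset.range n) _
        ((iIndepFun_interarrival μ ν).comp (fun _ (w : Pos) => ENNReal.ofReal (Real.exp (-(w : ℝ))))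
          fun _ => hf) fun j => hf.comp (measurable_interarrival j)
      simp only [Function.comp_apply] at this
      rw [this, Finset.prod_congr rfl (g := fun _ => r), Finset.prod_const, Finset.card_range]
      intro j _
      rw [← lintegral_map hf (measurable_interarrival j), map_interarrival]
    have h2 : Measurable fun ω => ∏ j ∈ Finset.range n,
        ENNReal.ofReal (Real.exp (-(interarrival j ω : ℝ))) :=
      Finset.measurable_prod _ fun j _ => hf.comp (measurable_interarrival j)
    rw [← h1, ← lintegral_const_mul _ h2]
    have hmeas : MeasurableSet {ω | claimNumber t ω = ⊤} :=
      measurable_claimNumber t (MeasurableSet.singleton ⊤)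
    rw [← lintegral_indicator_one hmeas]
    refine lintegral_mono fun ω => ?_
    by_cases hω : ω ∈ {ω | claimNumber t ω = ⊤}
    · rw [Set.indicator_of_mem hω, ← ENNReal.ofReal_prod_of_nonneg fun _ _ => (Real.exp_pos _).le,
        ← Real.exp_sum, ← ENNReal.ofReal_mul (Real.exp_pos _).le, ← Real.exp_add,
        Finset.sum_neg_distrib, Pi.one_apply, ENNReal.one_le_ofReal, Real.one_le_exp_iff]
      have h2 : arrival n ω ≤ t := (coe_le_claimNumber_iff n t ω).1 (by
        rw [show claimNumber t ω = ⊤ from hω]; exact le_top)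
      simp only [arrival] at h2
      linarith
    · rw [Set.indicator_of_notMem hω]
      exact zero_le
  have hlim := ENNReal.Tendsto.const_mul (a := ENNReal.ofReal (Real.exp t))
    (ENNReal.tendsto_pow_atTop_nhds_zero_of_lt_one (lintegral_exp_neg_lt_one μ))
    (Or.inr ENNReal.ofReal_ne_top)
  rw [mul_zero] at hlim
  exact le_antisymm (ge_of_tendsto' hlim hbound) zero_le

/-- The measure `ρ` is arbitrary so that this also applies to a measure given by a density. -/
lemma measure_eq_tsum_claimNumber {ρ : Measure ClaimSpace} {t : ℝ≥0}
    (h : ρ {ω | claimNumber t ω = ⊤} = 0) {A : Set ClaimSpace} (hA : MeasurableSet A) :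
    ρ A = ∑' n : ℕ, ρ (A ∩ {ω | claimNumber t ω = n}) := by
  have hmeas : ∀ n : ℕ, MeasurableSet (A ∩ {ω | claimNumber t ω = n}) := fun n =>
    hA.inter (measurable_claimNumber t (MeasurableSet.singleton (n : ℕ∞)))
  rw [← measure_iUnion _ hmeas]
  · refine measure_congr ?_
    filter_upwards [measure_eq_zero_iff_ae_notMem.1 h] with ω hω
    refine propext ⟨fun hωA => Set.mem_iUnion.2 ⟨claimCount t ω, hωA, ?_⟩, fun hω' => ?_⟩
    · exact (ENat.natCast_toNat hω).symm
    · obtain ⟨n, hn⟩ := Set.mem_iUnion.1 hω'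
      exact hn.1
  · intro m n hmn
    refine Set.disjoint_left.2 fun ω h1 h2 => hmn ?_
    exact_mod_cast h1.2.symm.trans h2.2

/-! ### Traces of the filtrations on `{N_t = n}` -/

/-- The indices of `W_1, ..., W_a, X_1, ..., X_b` among all coordinates. -/
def prefixIndex (a b : ℕ) : Finset (ℕ ⊕ ℕ) := (Finset.range a).disjSum (Finset.range b)

/-- The σ-algebra generated by `W_1, ..., W_a, X_1, ..., X_b`. -/
abbrev prefixSpace (a b : ℕ) : MeasurableSpace ClaimSpace :=
  MeasurableSpace.comap (fun ω (i : prefixIndex a b) => coordinate i ω) inferInstance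

lemma prefixSpace_le (a b : ℕ) : prefixSpace a b ≤ Prod.instMeasurableSpace :=
  measurable_iff_comap_le.1 (measurable_pi_lambda _ fun i => measurable_coordinate i)

lemma measurable_coordinate_prefixSpace {a b : ℕ} {i : ℕ ⊕ ℕ} (hi : i ∈ prefixIndex a b) :
    Measurable[prefixSpace a b] (coordinate i) :=
  (measurable_pi_apply (⟨i, hi⟩ : prefixIndex a b)).comp
    (comap_measurable fun ω (i : prefixIndex a b) => coordinate i ω)

lemma measurable_interarrival_prefixSpace {a j : ℕ} (b : ℕ) (h : j < a) :
    Measurable[prefixSpace a b] (interarrival j) :=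
  measurable_coordinate_prefixSpace (i := .inl j) (by simpa [prefixIndex] using h)

lemma measurable_claimSize_prefixSpace (a : ℕ) {b j : ℕ} (h : j < b) :
    Measurable[prefixSpace a b] (claimSize j) :=
  measurable_coordinate_prefixSpace (i := .inr j) (by simpa [prefixIndex] using h)

lemma measurable_arrival_prefixSpace {a k : ℕ} (b : ℕ) (h : k ≤ a) :
    Measurable[prefixSpace a b] (arrival k) :=
  Finset.measurable_sum _ fun _ hj => measurable_subtype_coe.comp
    (measurable_interarrival_prefixSpace b ((Finset.mem_range.1 hj).trans_le h))

/-- The trace of a σ-algebra on `E` is encoded as its `comap` along the inclusion. As `comap`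
commutes with suprema, an inclusion of traces can be checked on each generating random variable. -/
lemma exists_inter_eq_of_comap_le {Ω : Type*} {m m' : MeasurableSpace Ω} {E : Set Ω}
    (h : m.comap (Subtype.val : E → Ω) ≤ m'.comap Subtype.val) {A : Set Ω}
    (hA : MeasurableSet[m] A) : ∃ A', MeasurableSet[m'] A' ∧ A ∩ E = A' ∩ E := by
  obtain ⟨A', hA', he⟩ := h _ ⟨A, hA, rfl⟩
  refine ⟨A', hA', ?_⟩
  rw [Set.inter_comm A, Set.inter_comm A']
  exact (Subtype.preimage_val_eq_preimage_val_iff E A' A).1 he |>.symm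

lemma comap_val_comap_le_of_eqOn {Ω β : Type*} [MeasurableSpace β] {m' : MeasurableSpace Ω}
    {E : Set Ω} {f g : Ω → β} (hg : Measurable[m'] g) (h : Set.EqOn f g E) :
    (MeasurableSpace.comap f inferInstance).comap (Subtype.val : E → Ω) ≤
      m'.comap Subtype.val := by
  rw [MeasurableSpace.comap_comp]
  have : f ∘ (Subtype.val : E → Ω) = g ∘ Subtype.val := funext fun x => h x.2
  rw [this, ← MeasurableSpace.comap_comp]
  exact MeasurableSpace.comap_mono (measurable_iff_comap_le.1 hg)

/-- For `u ≤ t` on `{N_t = n}`, no claim after the `n`-th contributes to `S_u`, and whether the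
first `n` do is read off `T_1, ..., T_n`. The slack `n ≤ a` serves both `a = n` and `a = n + 1`. -/
lemma comap_filtrationF_le (t : ℝ≥0) {a n : ℕ} (hn : n ≤ a) :
    (filtrationF t).comap (Subtype.val : {ω | claimNumber t ω = n} → ClaimSpace) ≤
      (prefixSpace a n).comap Subtype.val := by
  change (⨆ u ≤ t, MeasurableSpace.comap (aggregateClaims u) inferInstance).comap _ ≤ _
  simp only [MeasurableSpace.comap_iSup]
  refine iSup₂_le fun u hu => ?_
  refine comap_val_comap_le_of_eqOn (g := fun ω => ∑ k ∈ Finset.range n,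
    if arrival (k + 1) ω ≤ u then ENNReal.ofReal (claimSize k ω) else 0) ?_ fun ω hω => ?_
  · refine Finset.measurable_sum _ fun k hk => Measurable.ite ?_ ?_ measurable_const
    · exact measurableSet_le (measurable_arrival_prefixSpace n
        (Nat.succ_le_of_lt ((Finset.mem_range.1 hk).trans_le hn))) measurable_const
    · exact ENNReal.measurable_ofReal.comp (measurable_subtype_coe.comp
        (measurable_claimSize_prefixSpace a (Finset.mem_range.1 hk)))
  · rw [aggregateClaims_eq_tsum, tsum_eq_sum (s := Finset.range n)]
    intro k hk
    refine if_neg (not_le.2 ?_)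
    have hk' : n ≤ k := not_lt.1 (Finset.mem_range.not.1 hk)
    calc (u : ℝ) ≤ t := hu
      _ < arrival (n + 1) ω := ((claimNumber_eq_coe_iff n t ω).1 hω).2
      _ ≤ arrival (k + 1) ω := (arrival_strictMono ω).monotone (by omega)

/-- The time `T_{N_u+1}` is the sum of the `W_{k+1}` whose waiting period has begun, that is `T_k ≤
u`. Since `N_u` may equal `n`, the variable `W_{n+1}` is needed. -/
lemma comap_filtrationV_le (t : ℝ≥0) (n b : ℕ) :
    (filtrationV t).comap (Subtype.val : {ω | claimNumber t ω = n} → ClaimSpace) ≤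
      (prefixSpace (n + 1) b).comap Subtype.val := by
  change (⨆ u ≤ t, MeasurableSpace.comap (forwardTime u) inferInstance).comap _ ≤ _
  simp only [MeasurableSpace.comap_iSup]
  refine iSup₂_le fun u hu => ?_
  refine comap_val_comap_le_of_eqOn (g := fun ω => (∑ k ∈ Finset.range (n + 1),
    if arrival k ω ≤ u then (interarrival k ω : ℝ) else 0) - u) ?_ fun ω hω => ?_
  · refine Measurable.sub_const (Finset.measurable_sum _ fun k hk =>
      Measurable.ite ?_ ?_ measurable_const) _
    · exact measurableSet_le (measurable_arrival_prefixSpace b (Finset.mem_range.1 hk).le)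
        measurable_const
    · exact measurable_subtype_coe.comp
        (measurable_interarrival_prefixSpace b (Finset.mem_range.1 hk))
  · have hlt : (u : ℝ) < arrival (n + 1) ω :=
      lt_of_le_of_lt hu ((claimNumber_eq_coe_iff n t ω).1 hω).2
    obtain ⟨c, hc⟩ : ∃ c : ℕ, claimNumber u ω = c := by
      refine ENat.ne_top_iff_exists.1 (fun h => ?_) |>.imp fun _ => Eq.symm
      exact absurd ((coe_le_claimNumber_iff (n + 1) u ω).1 (h ▸ le_top)) (not_le.2 hlt)
    beta_reduce
    rw [forwardTime, claimCount_of_claimNumber_eq hc, ← Finset.sum_filter, arrival]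
    congr 2
    ext k
    simp only [Finset.mem_range, Finset.mem_filter, ← coe_le_claimNumber_iff, hc, Nat.cast_le]
    rw [← not_le, ← coe_le_claimNumber_iff, hc, Nat.cast_le] at hlt
    omega

lemma measurableSet_claimNumber_eq_prefixSpace (t : ℝ≥0) (n b : ℕ) :
    MeasurableSet[prefixSpace (n + 1) b] {ω | claimNumber t ω = n} := by
  simp only [claimNumber_eq_coe_iff]
  exact (measurableSet_le (measurable_arrival_prefixSpace b n.le_succ) measurable_const).inter
    (measurableSet_lt measurable_const (measurable_arrival_prefixSpace b le_rfl))

lemma measurableSet_inter_claimNumber_of_filtrationH {t : ℝ≥0} {A : Set ClaimSpace}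
    (hA : MeasurableSet[filtrationH t] A) (n : ℕ) :
    MeasurableSet[prefixSpace (n + 1) n] (A ∩ {ω | claimNumber t ω = n}) := by
  have h : (filtrationH t).comap (Subtype.val : {ω | claimNumber t ω = n} → ClaimSpace) ≤
      (prefixSpace (n + 1) n).comap Subtype.val := by
    change (filtrationF t ⊔ filtrationV t).comap _ ≤ _
    rw [MeasurableSpace.comap_sup]
    exact sup_le (comap_filtrationF_le t n.le_succ) (comap_filtrationV_le t n n)
  obtain ⟨A', hA', he⟩ := exists_inter_eq_of_comap_le h hA
  rw [he]
  exact hA'.inter (measurableSet_claimNumber_eq_prefixSpace t n n)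

/-- The event `{N_t = n}` involves `W_{n+1}`, so the intersection itself need not lie in
`prefixSpace n n`; only a representative `A'` of `A` does. -/
lemma exists_inter_claimNumber_of_filtrationF {t : ℝ≥0} {A : Set ClaimSpace}
    (hA : MeasurableSet[filtrationF t] A) (n : ℕ) : ∃ A', MeasurableSet[prefixSpace n n] A' ∧
      A ∩ {ω | claimNumber t ω = n} = A' ∩ {ω | claimNumber t ω = n} :=
  exists_inter_eq_of_comap_le (comap_filtrationF_le t le_rfl) hA

/-! ### Densities on the filtrations -/

/-- The measure with density `exp f` with respect to `μ`. -/
def expDensity (μ : Measure Pos) (f : Pos → ℝ) : Measure Pos :=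
  μ.withDensity fun w => ENNReal.ofReal (Real.exp (f w))

lemma processL_of_claimNumber_eq {γ δ : Pos → ℝ} {n : ℕ} {t : ℝ≥0} {ω : ClaimSpace}
    (h : claimNumber t ω = n) : ENNReal.ofReal (processL γ δ t ω) =
      ∏ i ∈ prefixIndex (n + 1) n, Sum.elim (fun _ w => ENNReal.ofReal (Real.exp (δ w)))
        (fun _ x => ENNReal.ofReal (Real.exp (γ x))) i (coordinate i ω) := by
  rw [prefixIndex, Finset.prod_disjSum]
  simp only [Sum.elim_inl, Sum.elim_inr, coordinate]
  rw [← ENNReal.ofReal_prod_of_nonneg fun _ _ => (Real.exp_pos _).le,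
    ← ENNReal.ofReal_prod_of_nonneg fun _ _ => (Real.exp_pos _).le,
    ← ENNReal.ofReal_mul (Finset.prod_nonneg fun _ _ => (Real.exp_pos _).le),
    ← Real.exp_sum, ← Real.exp_sum, ← Real.exp_add, add_comm, processL, sumClaims,
    sumInterarrivals, claimCount_of_claimNumber_eq h]

section

variable {μ ν μ' ν' : Measure Pos} [IsProbabilityMeasure μ] [IsProbabilityMeasure ν]
  [IsProbabilityMeasure μ'] [IsProbabilityMeasure ν'] {γ δ : Pos → ℝ}

/-- The product density on the first `n + 1` interarrival times and `n` claims coincides with `L_t`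
on `{N_t = n}`. -/
lemma measure_inter_claimNumber_eq_setLIntegral_processL (hγ : Measurable γ) (hδ : Measurable δ)
    (hμ' : μ' = expDensity μ δ) (hν' : ν' = expDensity ν γ) {t : ℝ≥0} {A : Set ClaimSpace}
    (hA : MeasurableSet[filtrationH t] A) (n : ℕ) :
    canonicalMeasure μ' ν' (A ∩ {ω | claimNumber t ω = n}) =
      ∫⁻ ω in A ∩ {ω | claimNumber t ω = n}, ENNReal.ofReal (processL γ δ t ω)
        ∂(canonicalMeasure μ ν) := by
  have hmeas := measurableSet_inter_claimNumber_of_filtrationH hA n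
  rw [measure_eq_setLIntegral_prod_of_iIndepFun measurable_coordinate (iIndepFun_coordinate μ ν)
    (iIndepFun_coordinate μ' ν') (φ := Sum.elim (fun _ w => ENNReal.ofReal (Real.exp (δ w)))
        (fun _ x => ENNReal.ofReal (Real.exp (γ x)))) ?_ ?_ (prefixIndex (n + 1) n) hmeas]
  · refine setLIntegral_congr_fun (prefixSpace_le _ _ _ hmeas) fun ω hω => ?_
    exact (processL_of_claimNumber_eq hω.2).symm
  · rintro (i | i)
    · exact (Real.measurable_exp.comp hδ).ennreal_ofReal
    · exact (Real.measurable_exp.comp hγ).ennreal_ofReal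
  · rintro (i | i)
    · rw [map_coordinate, map_coordinate]
      exact hμ'
    · rw [map_coordinate, map_coordinate]
      exact hν'

lemma eq_setLIntegral_of_forall_claimNumber {t : ℝ≥0} {Z : ClaimSpace → ℝ≥0∞} {A : Set ClaimSpace}
    (hA : MeasurableSet A)
    (h : ∀ n : ℕ, canonicalMeasure μ' ν' (A ∩ {ω | claimNumber t ω = n}) =
      ∫⁻ ω in A ∩ {ω | claimNumber t ω = n}, Z ω ∂(canonicalMeasure μ ν)) :
    canonicalMeasure μ' ν' A = ∫⁻ ω in A, Z ω ∂(canonicalMeasure μ ν) := by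
  rw [measure_eq_tsum_claimNumber (measure_claimNumber_eq_top μ' ν' t) hA,
    ← withDensity_apply _ hA, measure_eq_tsum_claimNumber (t := t)
      (withDensity_absolutelyContinuous _ _ (measure_claimNumber_eq_top μ ν t)) hA]
  refine tsum_congr fun n => ?_
  rw [h n, withDensity_apply]
  exact hA.inter (measurable_claimNumber t (MeasurableSet.singleton (n : ℕ∞)))

theorem measure_eq_setLIntegral_processL (hγ : Measurable γ) (hδ : Measurable δ)
    (hμ' : μ' = expDensity μ δ) (hν' : ν' = expDensity ν γ) {t : ℝ≥0} {A : Set ClaimSpace}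
    (hA : MeasurableSet[filtrationH t] A) :
    canonicalMeasure μ' ν' A =
      ∫⁻ ω in A, ENNReal.ofReal (processL γ δ t ω) ∂(canonicalMeasure μ ν) :=
  eq_setLIntegral_of_forall_claimNumber (filtrationH.le t A hA) fun n =>
    measure_inter_claimNumber_eq_setLIntegral_processL hγ hδ hμ' hν' hA n

lemma indep_prefixSpace_interarrival (n : ℕ) :
    Indep (prefixSpace n n) (MeasurableSpace.comap (interarrival n) inferInstance)
      (canonicalMeasure μ ν) := by
  have h := (iIndepFun_coordinate μ ν).indepFun_finset (prefixIndex n n) {.inl n}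
    (by simp [prefixIndex]) measurable_coordinate
  exact h.comp measurable_id
    (measurable_pi_apply (⟨.inl n, by simp⟩ : ({.inl n} : Finset (ℕ ⊕ ℕ))))

end

lemma lintegral_comp_prodMk_of_indepFun {Ω α β : Type*} [MeasurableSpace Ω] [MeasurableSpace α]
    [MeasurableSpace β] {P : Measure Ω} [IsFiniteMeasure P] {Y : Ω → α} {W : Ω → β}
    (hY : Measurable Y) (hW : Measurable W) (h : IndepFun Y W P) {g : α × β → ℝ≥0∞}
    (hg : Measurable g) :
    ∫⁻ ω, g (Y ω, W ω) ∂P = ∫⁻ ω, ∫⁻ w, g (Y ω, w) ∂(P.map W) ∂P := by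
  rw [← lintegral_map hg (hY.prodMk hW),
    (indepFun_iff_map_prod_eq_prod_map_map hY.aemeasurable hW.aemeasurable).1 h,
    lintegral_prod _ hg.aemeasurable, lintegral_map hg.lintegral_prod_right' hY]

/-- Fubini with the past `m` frozen. It is used with `W = W_{n+1}` and `r = t - T_n`, taking `f =
exp δ` for `L` and `f = 1` for `M`. -/
lemma lintegral_mul_ite_lt_of_indep {Ω : Type*} {m m0 : MeasurableSpace Ω} (hm : m ≤ m0)
    {P : Measure Ω} [IsFiniteMeasure P] {W : Ω → Pos} (hW : Measurable W)
    (h : Indep m (MeasurableSpace.comap W inferInstance) P) {k : Ω → ℝ≥0∞} {r : Ω → ℝ}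
    (hk : Measurable[m] k) (hr : Measurable[m] r) {f : Pos → ℝ≥0∞} (hf : Measurable f) :
    ∫⁻ ω, k ω * (if r ω < W ω then f (W ω) else 0) ∂P =
      ∫⁻ ω, k ω * ∫⁻ w in {w : Pos | r ω < w}, f w ∂(P.map W) ∂P := by
  have hind : IndepFun (fun ω => (k ω, r ω)) W P :=
    indep_of_indep_of_le_left h (measurable_iff_comap_le.1 (hk.prodMk hr))
  have hg : Measurable fun p : (ℝ≥0∞ × ℝ) × Pos => p.1.1 * if p.1.2 < p.2 then f p.2 else 0 := by
    refine measurable_fst.fst.mul (Measurable.ite ?_ (hf.comp measurable_snd) measurable_const)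
    exact measurableSet_lt measurable_fst.snd (measurable_subtype_coe.comp measurable_snd)
  rw [lintegral_comp_prodMk_of_indepFun ((hk.mono hm le_rfl).prodMk (hr.mono hm le_rfl)) hW hind hg]
  refine lintegral_congr fun ω => ?_
  have hs : MeasurableSet {w : Pos | r ω < w} :=
    measurableSet_lt measurable_const measurable_subtype_coe
  rw [← lintegral_indicator hs, ← lintegral_const_mul _ (hf.indicator hs)]
  rfl

/-- On a null set `s` both sides vanish, so the convention `0 / 0 = 0` is harmless and positivity of
the tail need not be discussed. -/
lemma ofReal_div_mul_measure_tail {μ : Measure Pos} [IsProbabilityMeasure μ] {f : Pos → ℝ}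
    (hf : Integrable f μ) (h0 : ∀ w, 0 ≤ f w) (s : Set Pos) :
    ENNReal.ofReal ((∫ w in s, f w ∂μ) / ∫ _w in s, (1 : ℝ) ∂μ) * μ s =
      ∫⁻ w in s, ENNReal.ofReal (f w) ∂μ := by
  by_cases hs : μ s = 0
  · rw [hs, mul_zero, setLIntegral_measure_zero s _ hs]
  · have h1 : ∫ _w in s, (1 : ℝ) ∂μ = (μ s).toReal := by simp [Measure.real]
    rw [h1, ENNReal.ofReal_div_of_pos (ENNReal.toReal_pos hs (measure_ne_top μ s)),
      ENNReal.ofReal_toReal (measure_ne_top μ s),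
      ENNReal.div_mul_cancel hs (measure_ne_top μ s),
      ofReal_integral_eq_lintegral_ofReal hf.integrableOn (ae_of_all _ h0)]

section

variable {μ ν μ' ν' : Measure Pos} [IsProbabilityMeasure μ] [IsProbabilityMeasure ν]
  [IsProbabilityMeasure μ'] [IsProbabilityMeasure ν'] {γ δ : Pos → ℝ}

/-- On each `{N_t = n}` both `L_t` and `M_t` split into a factor of the past and one of `W_{n+1}`.
Once `W_{n+1}` is integrated out, the ratio in `M_t` times the tail mass is the tail integral of
`exp δ` produced by `L_t`. -/
theorem measure_eq_setLIntegral_processM (hγ : Measurable γ) (hδ : Measurable δ)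
    (hint : Integrable (fun w => Real.exp (δ w)) μ)
    (hμ' : μ' = expDensity μ δ) (hν' : ν' = expDensity ν γ) {t : ℝ≥0} {A : Set ClaimSpace}
    (hA : MeasurableSet[filtrationF t] A) :
    canonicalMeasure μ' ν' A = ∫⁻ ω in A,
      ENNReal.ofReal (processM (canonicalMeasure μ ν) γ δ t ω) ∂(canonicalMeasure μ ν) := by
  refine eq_setLIntegral_of_forall_claimNumber (t := t) (filtrationF.le t A hA) fun n => ?_
  rw [measure_inter_claimNumber_eq_setLIntegral_processL hγ hδ hμ' hν'
    (filtrationF_le_filtrationH t A hA) n]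
  set P := canonicalMeasure μ ν with hP
  obtain ⟨A', hA', he⟩ := exists_inter_claimNumber_of_filtrationF hA n
  have hE : MeasurableSet (A' ∩ {ω | claimNumber t ω = n}) :=
    (prefixSpace_le _ _ _ hA').inter (measurable_claimNumber t (MeasurableSet.singleton (n : ℕ∞)))
  rw [he, ← lintegral_indicator hE, ← lintegral_indicator hE]
  let r : ClaimSpace → ℝ := fun ω => t - arrival n ω
  have hr : Measurable[prefixSpace n n] r :=
    (measurable_arrival_prefixSpace n le_rfl).const_sub _
  let q : ℝ → ℝ := fun x => (∫ w in {w : Pos | x < (w : ℝ)}, Real.exp (δ w) ∂μ) /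
    ∫ _w in {w : Pos | x < (w : ℝ)}, (1 : ℝ) ∂μ
  have hq : Measurable q := (measurable_setIntegral_tail hint fun _ => (Real.exp_pos _).le).div
    (measurable_setIntegral_tail (integrable_const 1) fun _ => zero_le_one)
  let k : ClaimSpace → ℝ≥0∞ := (A' ∩ {ω | arrival n ω ≤ t}).indicator fun ω =>
    ENNReal.ofReal (Real.exp (∑ j ∈ Finset.range n, γ (claimSize j ω) +
      ∑ j ∈ Finset.range n, δ (interarrival j ω)))
  have hk : Measurable[prefixSpace n n] k := by
    refine Measurable.indicator ?_ (hA'.inter (measurableSet_le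
      (measurable_arrival_prefixSpace n le_rfl) measurable_const))
    refine (Real.measurable_exp.comp (Measurable.add ?_ ?_)).ennreal_ofReal
    · exact Finset.measurable_sum _ fun j hj =>
        hγ.comp (measurable_claimSize_prefixSpace n (Finset.mem_range.1 hj))
    · exact Finset.measurable_sum _ fun j hj =>
        hδ.comp (measurable_interarrival_prefixSpace n (Finset.mem_range.1 hj))
  have hind := indep_prefixSpace_interarrival (μ := μ) (ν := ν) n
  -- `N_t = n` separates into `T_n ≤ t`, known from the past, and `t - T_n < W_{n+1}`, a constraint
  -- on the independent variable.
  have hmem : ∀ ω, ω ∈ A' ∩ {ω | claimNumber t ω = n} ↔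
      ω ∈ A' ∩ {ω | arrival n ω ≤ t} ∧ r ω < interarrival n ω := fun ω => by
    simp only [Set.mem_inter_iff, Set.mem_ofPred_eq, claimNumber_eq_coe_iff, and_assoc, r,
      arrival_succ, sub_lt_iff_lt_add']
  have hL : ∀ ω, (A' ∩ {ω | claimNumber t ω = n}).indicator
      (fun ω => ENNReal.ofReal (processL γ δ t ω)) ω =
      k ω * (if r ω < interarrival n ω then ENNReal.ofReal (Real.exp (δ (interarrival n ω)))
        else 0) := fun ω => by
    by_cases h : ω ∈ A' ∩ {ω | claimNumber t ω = n}
    · obtain ⟨h1, h2⟩ := (hmem ω).1 h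
      simp only [k]
      rw [Set.indicator_of_mem h, Set.indicator_of_mem h1, if_pos h2,
        ← ENNReal.ofReal_mul (Real.exp_pos _).le, ← Real.exp_add, processL, sumClaims,
        sumInterarrivals, claimCount_of_claimNumber_eq h.2, Finset.sum_range_succ, add_assoc]
    · rw [Set.indicator_of_notMem h]
      by_cases h1 : ω ∈ A' ∩ {ω | arrival n ω ≤ t}
      · rw [if_neg fun h2 => h ((hmem ω).2 ⟨h1, h2⟩), mul_zero]
      · simp only [k]
        rw [Set.indicator_of_notMem h1, zero_mul]
  have hM : ∀ ω, (A' ∩ {ω | claimNumber t ω = n}).indicator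
      (fun ω => ENNReal.ofReal (processM P γ δ t ω)) ω =
      (k ω * ENNReal.ofReal (q (r ω))) * (if r ω < interarrival n ω then 1 else 0) := fun ω => by
    by_cases h : ω ∈ A' ∩ {ω | claimNumber t ω = n}
    · obtain ⟨h1, h2⟩ := (hmem ω).1 h
      simp only [k]
      rw [Set.indicator_of_mem h, Set.indicator_of_mem h1, if_pos h2, mul_one,
        ← ENNReal.ofReal_mul (Real.exp_pos _).le, processM, backwardTime, sumClaims,
        sumInterarrivals, claimCount_of_claimNumber_eq h.2, hP, map_interarrival]
    · rw [Set.indicator_of_notMem h]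
      by_cases h1 : ω ∈ A' ∩ {ω | arrival n ω ≤ t}
      · rw [if_neg fun h2 => h ((hmem ω).2 ⟨h1, h2⟩), mul_zero]
      · simp only [k]
        rw [Set.indicator_of_notMem h1, zero_mul, zero_mul]
  rw [lintegral_congr hL, lintegral_congr hM,
    lintegral_mul_ite_lt_of_indep (prefixSpace_le n n) (measurable_interarrival n) hind hk hr
      (f := fun w => ENNReal.ofReal (Real.exp (δ w))) (Real.measurable_exp.comp hδ).ennreal_ofReal,
    lintegral_mul_ite_lt_of_indep (prefixSpace_le n n) (measurable_interarrival n) hind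
      (k := fun ω => k ω * ENNReal.ofReal (q (r ω))) (hk.mul (hq.comp hr).ennreal_ofReal) hr
      (f := fun _ => 1) measurable_const]
  refine lintegral_congr fun ω => ?_
  rw [map_interarrival, setLIntegral_one, mul_assoc,
    ofReal_div_mul_measure_tail hint fun _ => (Real.exp_pos _).le]

end

/-! ### Density processes -/

section DensityProcess

variable {P Q : Measure ClaimSpace} [IsProbabilityMeasure P]
  {𝒢 : Filtration ℝ≥0 (inferInstance : MeasurableSpace ClaimSpace)} {Z : ℝ≥0 → ClaimSpace → ℝ}

lemma isDensityProcess_of_forall_eq_setLIntegral (hZ : ∀ t, Measurable[𝒢 t] (Z t))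
    (h : ∀ t A, MeasurableSet[𝒢 t] A → Q A = ∫⁻ ω in A, ENNReal.ofReal (Z t ω) ∂P) :
    IsDensityProcess Q P 𝒢 Z := by
  intro t
  have : Q.trim (𝒢.le t) =
      (P.trim (𝒢.le t)).withDensity fun ω => ENNReal.ofReal (Z t ω) := by
    refine @Measure.ext _ (𝒢 t) _ _ fun A hA => ?_
    rw [trim_measurableSet_eq _ hA, withDensity_apply _ hA, restrict_trim _ _ hA,
      lintegral_trim _ (hZ t).ennreal_ofReal, h t A hA]
  rw [this]
  exact Measure.rnDeriv_withDensity _ (hZ t).ennreal_ofReal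

/-- `rnDeriv` ignores a singular part, so absolute continuity on each `𝒢 t` is a separate
hypothesis. -/
lemma IsDensityProcess.eq_setLIntegral [IsProbabilityMeasure Q]
    (hZ : ∀ t, Measurable[𝒢 t] (Z t))
    (hd : IsDensityProcess Q P 𝒢 Z)
    (hac : ∀ t A, MeasurableSet[𝒢 t] A → P A = 0 → Q A = 0) (t : ℝ≥0) {A : Set ClaimSpace}
    (hA : MeasurableSet[𝒢 t] A) : Q A = ∫⁻ ω in A, ENNReal.ofReal (Z t ω) ∂P := by
  have h1 : Q.trim (𝒢.le t) ≪ P.trim (𝒢.le t) := by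
    refine @Measure.AbsolutelyContinuous.mk _ (𝒢 t) _ _ fun B hB h0 => ?_
    rw [trim_measurableSet_eq _ hB] at h0 ⊢
    exact hac t B hB h0
  rw [← trim_measurableSet_eq (𝒢.le t) hA, ← Measure.withDensity_rnDeriv_eq _ _ h1,
    withDensity_congr_ae (hd t), withDensity_apply _ hA, restrict_trim _ _ hA,
    lintegral_trim _ (hZ t).ennreal_ofReal]

/-- For `A` in `𝒢 s` the integrals of `Z s` and `Z t` over `A` both equal `Q A`. The set `{Z t = 0}`
is `Q`-null, hence `P`-null. -/
lemma isPositiveUnitMartingale_of_forall_eq_setLIntegral [IsProbabilityMeasure Q]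
    (hZ : ∀ t, Measurable[𝒢 t] (Z t)) (h0 : ∀ t ω, 0 ≤ Z t ω)
    (h : ∀ t A, MeasurableSet[𝒢 t] A → Q A = ∫⁻ ω in A, ENNReal.ofReal (Z t ω) ∂P)
    (hac : ∀ t A, MeasurableSet[𝒢 t] A → Q A = 0 → P A = 0) :
    IsPositiveUnitMartingale P 𝒢 Z := by
  have hm : ∀ t, Measurable (Z t) := fun t => (hZ t).mono (𝒢.le t) le_rfl
  have hset : ∀ t A, MeasurableSet[𝒢 t] A → ∫ ω in A, Z t ω ∂P = (Q A).toReal := by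
    intro t A hA
    rw [integral_eq_lintegral_of_nonneg_ae (ae_of_all _ (h0 t)) (hm t).aestronglyMeasurable,
      h t A hA]
  have hint : ∀ t, Integrable (Z t) P := fun t => by
    refine ⟨(hm t).aestronglyMeasurable, ?_⟩
    rw [hasFiniteIntegral_iff_ofReal (ae_of_all _ (h0 t)), ← setLIntegral_univ,
      ← h t _ MeasurableSet.univ, measure_univ]
    exact ENNReal.one_lt_top
  refine ⟨⟨fun t => (hZ t).stronglyMeasurable, fun s t hst => ?_⟩, fun t => ?_, fun t => ?_⟩
  · refine (ae_eq_condExp_of_forall_setIntegral_eq (𝒢.le s) (hint t)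
      (fun A _ _ => (hint s).integrableOn) (fun A hA _ => ?_)
      (hZ s).stronglyMeasurable.aestronglyMeasurable).symm
    rw [hset s A hA, hset t A (𝒢.mono hst A hA)]
  · have hA : MeasurableSet[𝒢 t] {ω | Z t ω = 0} := hZ t (MeasurableSet.singleton 0)
    have hQ : Q {ω | Z t ω = 0} = 0 := by
      rw [h t _ hA, setLIntegral_congr_fun (g := fun _ => 0) (𝒢.le t _ hA) fun ω hω => ?_]
      · simp
      · rw [show Z t ω = 0 from hω, ENNReal.ofReal_zero]
    filter_upwards [measure_eq_zero_iff_ae_notMem.1 (hac t _ hA hQ)] with ω hω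
    exact lt_of_le_of_ne (h0 t ω) (Ne.symm hω)
  · rw [← setIntegral_univ, hset t _ MeasurableSet.univ, measure_univ, ENNReal.toReal_one]

end DensityProcess

/-! ### Exponential densities -/

/-- A nonintegrable function has integral `0` by convention, so the value `1` forces integrability.
-/
lemma integrable_exp_of_integral_eq_one {μ : Measure Pos} {f : Pos → ℝ}
    (h : ∫ w, Real.exp (f w) ∂μ = 1) : Integrable (fun w => Real.exp (f w)) μ := by
  by_contra hn
  rw [integral_undef hn] at h
  exact zero_ne_one h

lemma isProbabilityMeasure_expDensity {μ : Measure Pos} {f : Pos → ℝ}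
    (h : ∫ w, Real.exp (f w) ∂μ = 1) : IsProbabilityMeasure (expDensity μ f) := by
  refine ⟨?_⟩
  rw [expDensity, withDensity_apply _ MeasurableSet.univ, setLIntegral_univ,
    ← ofReal_integral_eq_lintegral_ofReal (integrable_exp_of_integral_eq_one h)
      (ae_of_all _ fun _ => (Real.exp_pos _).le), h, ENNReal.ofReal_one]

lemma integral_exp_eq_one {μ : Measure Pos} {f : Pos → ℝ} (hf : Measurable f)
    [h : IsProbabilityMeasure (expDensity μ f)] : ∫ w, Real.exp (f w) ∂μ = 1 := by
  have h1 := h.measure_univ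
  rw [expDensity, withDensity_apply _ MeasurableSet.univ, setLIntegral_univ] at h1
  rw [integral_eq_lintegral_of_nonneg_ae (ae_of_all _ fun _ => (Real.exp_pos _).le)
    (Real.measurable_exp.comp hf).aestronglyMeasurable, h1, ENNReal.toReal_one]

/-- Equivalent probability measures have an exponential density. -/
lemma exists_eq_expDensity {μ μ' : Measure Pos} [IsProbabilityMeasure μ] [IsProbabilityMeasure μ']
    (h : μ' ≪ μ) (h' : μ ≪ μ') : ∃ f, Measurable f ∧ μ' = expDensity μ f := by
  refine ⟨fun w => Real.log (μ'.rnDeriv μ w).toReal,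
    Real.measurable_log.comp (Measure.measurable_rnDeriv _ _).ennreal_toReal, ?_⟩
  rw [expDensity, withDensity_congr_ae (g := μ'.rnDeriv μ), Measure.withDensity_rnDeriv_eq _ _ h]
  -- Positivity of the derivative is known only `μ'`-a.e.; `μ ≪ μ'` carries it over to `μ`, where
  -- `exp` then undoes `log`.
  filter_upwards [h'.ae_le (Measure.rnDeriv_pos h), Measure.rnDeriv_lt_top μ' μ] with w h1 h2
  rw [Real.exp_log (ENNReal.toReal_pos h1.ne' h2.ne), ENNReal.ofReal_toReal h2.ne]

lemma expDensity_eq_iff {μ : Measure Pos} {f g : Pos → ℝ} (hf : Measurable f) (hg : Measurable g)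
    [h : IsProbabilityMeasure (expDensity μ f)] :
    expDensity μ f = expDensity μ g ↔ f =ᵐ[μ] g := by
  have h1 := h.measure_univ
  rw [expDensity, withDensity_apply _ MeasurableSet.univ, setLIntegral_univ] at h1
  have hexp : ∀ {k : Pos → ℝ}, Measurable k →
      AEMeasurable (fun w => ENNReal.ofReal (Real.exp (k w))) μ := fun hk =>
    (Real.measurable_exp.comp hk).ennreal_ofReal.aemeasurable
  rw [expDensity, expDensity, withDensity_eq_iff (hexp hf) (hexp hg) (h1 ▸ ENNReal.one_ne_top)]
  refine ⟨fun h => ?_, fun h => ?_⟩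
  · filter_upwards [h] with w hw
    exact Real.exp_injective
      ((ENNReal.ofReal_eq_ofReal_iff (Real.exp_pos _).le (Real.exp_pos _).le).1 hw)
  · filter_upwards [h] with w hw
    rw [hw]

/-! ### Admissible pairs and structure preserving measures -/

section

variable {μ ν : Measure Pos} [IsProbabilityMeasure μ] [IsProbabilityMeasure ν] {γ δ : Pos → ℝ}

lemma isAdmissiblePair_canonicalMeasure_iff : IsAdmissiblePair (canonicalMeasure μ ν) γ δ ↔
    Measurable γ ∧ Measurable δ ∧ ∫ x, Real.exp (γ x) ∂ν = 1 ∧ ∫ w, Real.exp (δ w) ∂μ = 1 := by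
  have hX : Measurable γ → ∫ ω, Real.exp (γ (claimSize 0 ω)) ∂(canonicalMeasure μ ν) =
      ∫ x, Real.exp (γ x) ∂ν := fun h => by
    have := integral_map (μ := canonicalMeasure μ ν) (measurable_claimSize 0).aemeasurable
      (Real.measurable_exp.comp h).aestronglyMeasurable
    rw [map_claimSize] at this
    exact this.symm
  have hW : Measurable δ → ∫ ω, Real.exp (δ (interarrival 0 ω)) ∂(canonicalMeasure μ ν) =
      ∫ w, Real.exp (δ w) ∂μ := fun h => by
    have := integral_map (μ := canonicalMeasure μ ν) (measurable_interarrival 0).aemeasurable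
      (Real.measurable_exp.comp h).aestronglyMeasurable
    rw [map_interarrival] at this
    exact this.symm
  constructor
  · rintro ⟨h1, h2, h3, h4⟩
    exact ⟨h1, h2, hX h1 ▸ h3, hW h2 ▸ h4⟩
  · rintro ⟨h1, h2, h3, h4⟩
    exact ⟨h1, h2, (hX h1).trans h3, (hW h2).trans h4⟩

variable {μ' ν' : Measure Pos} [IsProbabilityMeasure μ'] [IsProbabilityMeasure ν']

lemma progressivelyEquivalent_canonicalMeasure (hγ : Measurable γ) (hδ : Measurable δ)
    (hμ' : μ' = expDensity μ δ) (hν' : ν' = expDensity ν γ) :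
    ProgressivelyEquivalent (canonicalMeasure μ' ν') (canonicalMeasure μ ν) filtrationH := by
  intro t A hA
  have hL : Measurable fun ω => ENNReal.ofReal (processL γ δ t ω) :=
    ((measurable_processL hγ hδ t).mono (filtrationH.le t) le_rfl).ennreal_ofReal
  rw [measure_eq_setLIntegral_processL hγ hδ hμ' hν' hA]
  refine ⟨fun h => setLIntegral_measure_zero _ _ h, fun h => ?_⟩
  rw [lintegral_eq_zero_iff hL] at h
  rw [← Measure.restrict_eq_zero, ← ae_eq_bot, ← Filter.eventually_false_iff_eq_bot]
  filter_upwards [h] with ω hω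
  exact (ENNReal.ofReal_pos.2 (Real.exp_pos _)).ne' hω

lemma isDensityProcess_processL (hγ : Measurable γ) (hδ : Measurable δ)
    (hμ' : μ' = expDensity μ δ) (hν' : ν' = expDensity ν γ) :
    IsDensityProcess (canonicalMeasure μ' ν') (canonicalMeasure μ ν) filtrationH
      (processL γ δ) :=
  isDensityProcess_of_forall_eq_setLIntegral (measurable_processL hγ hδ) fun _ _ hA =>
    measure_eq_setLIntegral_processL hγ hδ hμ' hν' hA

lemma measurable_processM_canonicalMeasure (hγ : Measurable γ) (hδ : Measurable δ)
    (hint : Integrable (fun w => Real.exp (δ w)) μ) (t : ℝ≥0) :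
    Measurable[filtrationF t] (processM (canonicalMeasure μ ν) γ δ t) :=
  measurable_processM hγ hδ (by rwa [map_interarrival]) t

lemma isDensityProcess_processM (hγ : Measurable γ) (hδ : Measurable δ)
    (hint : Integrable (fun w => Real.exp (δ w)) μ)
    (hμ' : μ' = expDensity μ δ) (hν' : ν' = expDensity ν γ) :
    IsDensityProcess (canonicalMeasure μ' ν') (canonicalMeasure μ ν) filtrationF
      (processM (canonicalMeasure μ ν) γ δ) :=
  isDensityProcess_of_forall_eq_setLIntegral (measurable_processM_canonicalMeasure hγ hδ hint)
    fun _ _ hA => measure_eq_setLIntegral_processM hγ hδ hint hμ' hν' hA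

lemma isPositiveUnitMartingale_processL (hγ : Measurable γ) (hδ : Measurable δ)
    (hμ' : μ' = expDensity μ δ) (hν' : ν' = expDensity ν γ) :
    IsPositiveUnitMartingale (canonicalMeasure μ ν) filtrationH (processL γ δ) :=
  isPositiveUnitMartingale_of_forall_eq_setLIntegral (Q := canonicalMeasure μ' ν')
    (measurable_processL hγ hδ) (fun _ _ => (Real.exp_pos _).le)
    (fun _ _ hA => measure_eq_setLIntegral_processL hγ hδ hμ' hν' hA)
    fun t A hA => (progressivelyEquivalent_canonicalMeasure hγ hδ hμ' hν' t A hA).2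

lemma processM_nonneg (P : Measure ClaimSpace) (γ δ : Pos → ℝ) (t : ℝ≥0) (ω : ClaimSpace) :
    0 ≤ processM P γ δ t ω :=
  mul_nonneg (Real.exp_pos _).le (div_nonneg (integral_nonneg fun _ => (Real.exp_pos _).le)
    (integral_nonneg fun _ => zero_le_one))

lemma isPositiveUnitMartingale_processM (hγ : Measurable γ) (hδ : Measurable δ)
    (hint : Integrable (fun w => Real.exp (δ w)) μ)
    (hμ' : μ' = expDensity μ δ) (hν' : ν' = expDensity ν γ) :
    IsPositiveUnitMartingale (canonicalMeasure μ ν) filtrationF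
      (processM (canonicalMeasure μ ν) γ δ) :=
  isPositiveUnitMartingale_of_forall_eq_setLIntegral (Q := canonicalMeasure μ' ν')
    (measurable_processM_canonicalMeasure hγ hδ hint) (processM_nonneg _ γ δ)
    (fun _ _ hA => measure_eq_setLIntegral_processM hγ hδ hint hμ' hν' hA)
    fun t A hA => (progressivelyEquivalent_canonicalMeasure hγ hδ hμ' hν' t A
      (filtrationF_le_filtrationH t A hA)).2

/-- No arrival occurs at time `0`, so `V_0 = W_1`. Hence `W_1` is `H_0`-measurable, and the null
sets of its two laws can be compared at time `0`. -/
lemma interarrival_zero_eq_forwardTime (ω : ClaimSpace) :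
    (interarrival 0 ω : ℝ) = forwardTime 0 ω := by
  have h : claimNumber 0 ω = (0 : ℕ) := (claimNumber_eq_coe_iff 0 0 ω).2
    ⟨by simp, by simpa using arrival_lt_succ 0 ω⟩
  rw [forwardTime, claimCount_of_claimNumber_eq h, arrival_succ]
  simp

lemma measurable_interarrival_zero_filtrationH : Measurable[filtrationH 0] (interarrival 0) := by
  have h : Measurable[filtrationH 0] fun ω => (interarrival 0 ω : ℝ) := by
    simp only [interarrival_zero_eq_forwardTime]
    exact measurable_forwardTime_filtrationH 0
  exact h.subtype_mk (h := fun ω => (interarrival 0 ω).2)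

variable (μ ν) in
lemma measure_interarrival_inter_claimSize {B C : Set Pos} (hB : MeasurableSet B)
    (hC : MeasurableSet C) :
    canonicalMeasure μ ν (interarrival 0 ⁻¹' C ∩ claimSize 0 ⁻¹' B) = μ C * ν B := by
  have h := ((iIndepFun_coordinate μ ν).indepFun
    (Sum.inl_ne_inr : (.inl 0 : ℕ ⊕ ℕ) ≠ .inr 0)).measure_inter_preimage_eq_mul C B hC hB
  rw [← Measure.map_apply (measurable_coordinate _) hC,
    ← Measure.map_apply (measurable_coordinate _) hB, map_coordinate, map_coordinate] at h
  exact h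

lemma measure_interarrival_eq_zero_iff
    (h : ProgressivelyEquivalent (canonicalMeasure μ' ν') (canonicalMeasure μ ν) filtrationH)
    {B : Set Pos} (hB : MeasurableSet B) : μ B = 0 ↔ μ' B = 0 := by
  have := h 0 _ (measurable_interarrival_zero_filtrationH hB)
  rwa [← Measure.map_apply (measurable_interarrival 0) hB,
    ← Measure.map_apply (measurable_interarrival 0) hB, map_interarrival, map_interarrival] at this

/-- `X_1` becomes visible only at time `T_1`. For `n` with `μ {w ≤ n} > 0`, the event `{W_1 ≤ n, X_1
∈ B}` lies in `F_n` and its measure factors; the first factor is nonzero for `μ` and `μ'`, so it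
cancels. -/
lemma measure_claimSize_eq_zero_iff
    (h : ProgressivelyEquivalent (canonicalMeasure μ' ν') (canonicalMeasure μ ν) filtrationH)
    {B : Set Pos} (hB : MeasurableSet B) : ν B = 0 ↔ ν' B = 0 := by
  have hC : ∀ n : ℕ, MeasurableSet {w : Pos | (w : ℝ) ≤ n} := fun n =>
    measurableSet_le measurable_subtype_coe measurable_const
  obtain ⟨n, hn⟩ : ∃ n : ℕ, μ {w : Pos | (w : ℝ) ≤ n} ≠ 0 := by
    by_contra! hall
    have h0 : μ (⋃ n : ℕ, {w : Pos | (w : ℝ) ≤ n}) = 0 := measure_iUnion_null hall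
    have hu : (⋃ n : ℕ, {w : Pos | (w : ℝ) ≤ n}) = Set.univ :=
      Set.eq_univ_of_forall fun w => Set.mem_iUnion.2 (exists_nat_ge (w : ℝ))
    rw [hu, measure_univ] at h0
    exact one_ne_zero h0
  have hn' := (measure_interarrival_eq_zero_iff h (hC n)).not.1 hn
  have hset : interarrival 0 ⁻¹' {w : Pos | (w : ℝ) ≤ n} ∩ claimSize 0 ⁻¹' B =
      {ω | arrival 1 ω ≤ ((n : ℝ≥0) : ℝ)} ∩ observedClaim 0 n ⁻¹' B := by
    ext ω
    have h1 : arrival 1 ω = interarrival 0 ω := by simp [arrival]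
    simp only [Set.mem_inter_iff, Set.mem_preimage, Set.mem_ofPred_eq, h1, NNReal.coe_natCast]
    refine and_congr_right fun hle => ?_
    rw [observedClaim, if_pos]
    simpa [h1] using hle
  have hmeas : MeasurableSet[filtrationH n]
      (interarrival 0 ⁻¹' {w : Pos | (w : ℝ) ≤ n} ∩ claimSize 0 ⁻¹' B) := by
    rw [hset]
    exact filtrationF_le_filtrationH _ _
      ((measurableSet_arrival_le 1 le_rfl).inter (measurable_observedClaim 0 n hB))
  have := h n _ hmeas
  rw [measure_interarrival_inter_claimSize μ ν hB (hC n),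
    measure_interarrival_inter_claimSize μ' ν' hB (hC n)] at this
  simpa [hn, hn'] using this

/-- A structure preserving measure is the canonical measure of a pair of measures with exponential
densities. -/
lemma IsStructurePreserving.exists_expDensity {Q : Measure ClaimSpace}
    (hQ : IsStructurePreserving (canonicalMeasure μ ν) Q) :
    ∃ (γ δ : Pos → ℝ) (_ : IsProbabilityMeasure (expDensity μ δ))
      (_ : IsProbabilityMeasure (expDensity ν γ)), Measurable γ ∧ Measurable δ ∧
        Q = canonicalMeasure (expDensity μ δ) (expDensity ν γ) := by
  have := hQ.isProbabilityMeasure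
  have hμ' : IsProbabilityMeasure (Q.map (interarrival 0)) :=
    Measure.isProbabilityMeasure_map (measurable_interarrival 0).aemeasurable
  have hν' : IsProbabilityMeasure (Q.map (claimSize 0)) :=
    Measure.isProbabilityMeasure_map (measurable_claimSize 0).aemeasurable
  have hQeq := hQ.isCompoundRenewal.eq_canonicalMeasure _ _ rfl rfl
  have hequiv := hQ.progressivelyEquivalent
  generalize Q.map (interarrival 0) = μ' at *
  generalize Q.map (claimSize 0) = ν' at *
  subst hQeq
  obtain ⟨δ, hδ, rfl⟩ := exists_eq_expDensity (μ := μ) (μ' := μ')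
    (.mk fun B hB h => (measure_interarrival_eq_zero_iff hequiv hB).1 h)
    (.mk fun B hB h => (measure_interarrival_eq_zero_iff hequiv hB).2 h)
  obtain ⟨γ, hγ, rfl⟩ := exists_eq_expDensity (μ := ν) (μ' := ν')
    (.mk fun B hB h => (measure_claimSize_eq_zero_iff hequiv hB).1 h)
    (.mk fun B hB h => (measure_claimSize_eq_zero_iff hequiv hB).2 h)
  exact ⟨γ, δ, hμ', hν', hγ, hδ, rfl⟩

lemma eq_canonicalMeasure_of_forall_eq_setLIntegral (hγ : Measurable γ) (hδ : Measurable δ)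
    (hμ' : μ' = expDensity μ δ) (hν' : ν' = expDensity ν γ) {Q : Measure ClaimSpace}
    [IsProbabilityMeasure Q]
    (h : ∀ t : ℝ≥0, ∀ A : Set ClaimSpace, MeasurableSet[filtrationH t] A →
      Q A = ∫⁻ ω in A, ENNReal.ofReal (processL γ δ t ω) ∂(canonicalMeasure μ ν)) :
    Q = canonicalMeasure μ' ν' := by
  refine eq_of_forall_filtrationF fun t A hA => ?_
  have hA' := filtrationF_le_filtrationH t A hA
  rw [h t A hA', measure_eq_setLIntegral_processL hγ hδ hμ' hν' hA']

/-- If the pair `(γ', δ')` gives the same densities, its canonical measure is the same one; equal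
marginals then mean almost everywhere equal exponents. -/
lemma isDensityProcess_processL_iff {γ' δ' : Pos → ℝ} (hγ : Measurable γ) (hδ : Measurable δ)
    (hμ' : μ' = expDensity μ δ) (hν' : ν' = expDensity ν γ)
    (hadm : IsAdmissiblePair (canonicalMeasure μ ν) γ' δ') :
    IsDensityProcess (canonicalMeasure μ' ν') (canonicalMeasure μ ν) filtrationH
      (processL γ' δ') ↔ γ' =ᵐ[ν] γ ∧ δ' =ᵐ[μ] δ := by
  obtain ⟨hγ', hδ', h1, h2⟩ := isAdmissiblePair_canonicalMeasure_iff.1 hadm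
  have := isProbabilityMeasure_expDensity h1
  have := isProbabilityMeasure_expDensity h2
  rw [← expDensity_eq_iff hγ' hγ, ← expDensity_eq_iff hδ' hδ, ← hμ', ← hν']
  constructor
  · intro hd
    have heq := eq_canonicalMeasure_of_forall_eq_setLIntegral hγ' hδ' rfl rfl fun t A hA =>
      hd.eq_setLIntegral (measurable_processL hγ' hδ') (fun t A hA =>
        (progressivelyEquivalent_canonicalMeasure hγ hδ hμ' hν' t A hA).1) t hA
    constructor
    · rw [← map_claimSize (expDensity μ δ') (expDensity ν γ') 0, ← heq, map_claimSize]
    · rw [← map_interarrival (expDensity μ δ') (expDensity ν γ') 0, ← heq, map_interarrival]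
  · rintro ⟨h3, h4⟩
    exact isDensityProcess_processL hγ' hδ' h4.symm h3.symm

end

end CompoundRenewal
end

open CompoundRenewal

theorem theorem2p1 (μ ν : Measure Pos) [IsProbabilityMeasure μ] [IsProbabilityMeasure ν]
    (P : Measure ClaimSpace) (hP : P = canonicalMeasure μ ν) :
    (∀ Q : Measure ClaimSpace, IsStructurePreserving P Q →
      ∃ γ δ : Pos → ℝ, IsAdmissiblePair P γ δ ∧
        IsDensityProcess Q P filtrationH (processL γ δ) ∧
        IsDensityProcess Q P filtrationF (processM P γ δ) ∧
        IsPositiveUnitMartingale P filtrationH (processL γ δ) ∧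
        IsPositiveUnitMartingale P filtrationF (processM P γ δ) ∧
        ∀ γ' δ' : Pos → ℝ, IsAdmissiblePair P γ' δ' →
          (IsDensityProcess Q P filtrationH (processL γ' δ') ↔
            γ' =ᵐ[P.map (claimSize 0)] γ ∧ δ' =ᵐ[P.map (interarrival 0)] δ)) ∧
    (∀ γ δ : Pos → ℝ, IsAdmissiblePair P γ δ →
      ∃ Q : Measure ClaimSpace, IsStructurePreserving P Q ∧
        (∀ t : ℝ≥0, ∀ A : Set ClaimSpace, MeasurableSet[filtrationH t] A →
          Q A = ∫⁻ ω in A, ENNReal.ofReal (processL γ δ t ω) ∂P) ∧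
        IsDensityProcess Q P filtrationF (processM P γ δ) ∧
        ∀ Q' : Measure ClaimSpace, IsProbabilityMeasure Q' →
          (∀ t : ℝ≥0, ∀ A : Set ClaimSpace, MeasurableSet[filtrationH t] A →
            Q' A = ∫⁻ ω in A, ENNReal.ofReal (processL γ δ t ω) ∂P) →
          Q' = Q) := by
  subst hP
  refine ⟨fun Q hQ => ?_, fun γ δ hadm => ?_⟩
  · obtain ⟨γ, δ, hμ', hν', hγ, hδ, rfl⟩ := hQ.exists_expDensity
    have hint := integrable_exp_of_integral_eq_one (integral_exp_eq_one (μ := μ) hδ)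
    refine ⟨γ, δ, isAdmissiblePair_canonicalMeasure_iff.2
        ⟨hγ, hδ, integral_exp_eq_one hγ, integral_exp_eq_one hδ⟩,
      isDensityProcess_processL hγ hδ rfl rfl, isDensityProcess_processM hγ hδ hint rfl rfl,
      isPositiveUnitMartingale_processL hγ hδ rfl rfl,
      isPositiveUnitMartingale_processM hγ hδ hint rfl rfl, fun γ' δ' hadm => ?_⟩
    rw [map_claimSize, map_interarrival]
    exact isDensityProcess_processL_iff hγ hδ rfl rfl hadm
  · obtain ⟨hγ, hδ, h1, h2⟩ := isAdmissiblePair_canonicalMeasure_iff.1 hadm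
    have := isProbabilityMeasure_expDensity h1
    have := isProbabilityMeasure_expDensity h2
    refine ⟨canonicalMeasure (expDensity μ δ) (expDensity ν γ),
      ⟨inferInstance, isCompoundRenewal_canonicalMeasure _ _,
        progressivelyEquivalent_canonicalMeasure hγ hδ rfl rfl⟩,
      fun t A hA => measure_eq_setLIntegral_processL hγ hδ rfl rfl hA,
      isDensityProcess_processM hγ hδ (integrable_exp_of_integral_eq_one h2) rfl rfl,
      fun Q' hQ' h => eq_canonicalMeasure_of_forall_eq_setLIntegral hγ hδ rfl rfl h⟩
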